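/- Let $\mathcal H_A=\mathbb C^{a}$ and $\mathcal H_B=\mathbb C^{b}$ be finite-dimensional Hilbert spaces. A (discrete) ensemble $\{p_x,\rho_x\}$ on $\mathcal H_A\otimes\mathcal H_B$ consists of a probability distribution $(p_x)$ on a finite or countable label set and density operators $\rho_x$ on $\mathcal H_A\otimes\mathcal H_B$; write $\rho=\sum_x p_x\rho_x$. Let $S_L(\sigma)=1-\operatorname{tr}(\sigma^2)$ be the linear entropy. For a measurement $\mathcal M$ let $I(X:\mathcal M)$ be the Shannon mutual information, in bits, between the label $X\sim(p_x)$ and the outcome of measuring $\mathcal M$ on $\rho_X$, i.e. the relative entropy (logarithm to base 2) of their joint law with respect to the product of its marginals. The LOCC-accessible information $I^{\rm LOCC}_{\rm acc}(\{p_x,\rho_x\})$ is the supremum of $I(X:\mathcal M)$ over all measurements $\mathcal M$ implementable by local operations and classical communication between $A$ and $B$ (protocols with finitely many rounds and finitely many outcomes per round). Let $\mathcal U_A\otimes\mathcal U_B$ be the tensor product of the uniform POVMs $\bigl(a\,|\varphi\rangle\langle\varphi|\,d\varphi\bigr)$ on $\mathcal H_A$ and $\bigl(b\,|\psi\rangle\langle\psi|\,d\psi\bigr)$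 on $\mathcal H_B$, where $d\varphi$, $d\psi$ are the uniform probability measures on the unit vectors. Then for every ensemble $\{p_x,\rho_x\}$ on $\mathcal H_A\otimes\mathcal H_B$, $$I^{\rm LOCC}_{\rm acc}\bigl(\{p_x,\rho_x\}\bigr)\;\ge\; I(X:\mathcal U_A\otimes\mathcal U_B)\;\ge\;\frac{1}{306\ln 2}\Bigl(S_L(\rho)-\sum_x p_x S_L(\rho_x)\Bigr).$$ Moreover, for every density operator $\rho$ on $\mathcal H_A\otimes\mathcal H_B$, the LOCC-subentropy $$Q^{\rm LOCC}(\rho):=\inf\Bigl\{I^{\rm LOCC}_{\rm acc}\bigl(\{p_x,\varphi_x\}\bigr) : \{p_x,\varphi_x\}\text{ an ensemble of pure states with }\sum_x p_x\varphi_x=\rho\Bigr\}$$ satisfies $$Q^{\rm LOCC}(\rho)\;\ge\;\frac{1}{306\ln 2}\bigl(1-\operatorname{tr}(\rho^2)\bigr).$$ -/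

import Mathlib

open MeasureTheory
open scoped ENNReal Kronecker ComplexOrder

noncomputable section

namespace LOCCInfo

/-- Operators on the bipartite Hilbert space `ℂ^a ⊗ ℂ^b`, as matrices in the product basis. -/
abbrev Op (a b : ℕ) : Type := Matrix (Fin a × Fin b) (Fin a × Fin b) ℂ

/-- Density operators: positive semidefinite with trace one. -/
structure IsState {a b : ℕ} (ρ : Op a b) : Prop where
  posSemidef : ρ.PosSemidef
  trace_eq_one : ρ.trace = 1

/-- Pure states `|v⟩⟨v|` with `v` a unit vector. -/
def IsPure {a b : ℕ} (ρ : Op a b) : Prop :=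
  ∃ v : Fin a × Fin b → ℂ, star v ⬝ᵥ v = 1 ∧ ρ = Matrix.vecMulVec v (star v)

/-- The linear entropy `1 - tr ρ²`. -/
def linearEntropy {a b : ℕ} (ρ : Op a b) : ℝ := 1 - (ρ * ρ).trace.re

/-- An ensemble `{p_x, ρ_x}` of bipartite states: a discrete probability distribution `p` on the
label set `X` and a state `ρ x` for every label. -/
structure Ensemble (X : Type*) (a b : ℕ) where
  p : PMF X
  ρ : X → Op a b
  isState : ∀ x, IsState (ρ x)

/-- The ensemble average `∑ₓ p_x ρ_x`. The series converges absolutely, since the entries of the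
`ρ_x` are bounded by one. -/
def Ensemble.average {X : Type*} {a b : ℕ} (E : Ensemble X a b) : Op a b :=
  ∑' x, (E.p x).toReal • E.ρ x

/-- The mutual information, in bits, of two random variables with joint law `π`: the relative
entropy of `π` with respect to the product of its marginals. -/
def mutualInfoOfJoint {X Ω : Type*} [MeasurableSpace X] [MeasurableSpace Ω]
    (π : Measure (X × Ω)) : ℝ≥0∞ :=
  InformationTheory.klDiv π (π.fst.prod π.snd) / ENNReal.ofReal (Real.log 2)

/-- The mutual information, in bits, between a discrete label `x` distributed according to `p` and
an outcome whose law given `x` is `P x`. The joint law is `∑ₓ p_x δ_x ⊗ P_x`, and the label set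
carries the discrete σ-algebra. -/
def mutualInfo {X Ω : Type*} [MeasurableSpace Ω] (p : PMF X) (P : X → Measure Ω) : ℝ≥0∞ :=
  letI : MeasurableSpace X := ⊤
  mutualInfoOfJoint (Measure.sum fun x => p x • (Measure.dirac x).prod (P x))

/-- The law of the outcome when the POVM `(M k)ₖ` is measured on `ρ`: outcome `k` has probability
`tr (ρ M_k)`. -/
def outcomeLaw {a b n : ℕ} (M : Fin n → Op a b) (ρ : Op a b) : Measure (Fin n) :=
  Measure.sum fun k => ENNReal.ofReal (ρ * M k).trace.re • Measure.dirac k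

/-- `IsLOCC M` says that the POVM `(M k)ₖ` on `ℂ^a ⊗ ℂ^b` is implemented by a protocol of local
operations and classical communication. Either the parties stop and output a label `k₀`; or one
party performs a local operation with Kraus operators `K i` (the output space may differ from the
input space and may depend on `i`), announces the outcome `i`, and the parties continue with an
LOCC protocol, implementing the POVM `N i`, that may depend on `i`. -/
inductive IsLOCC {n : ℕ} : {a b : ℕ} → (Fin n → Op a b) → Prop
  | done {a b : ℕ} (k₀ : Fin n) :
      IsLOCC (a := a) (b := b) fun k => if k = k₀ then 1 else 0
  | alice {a b m : ℕ} (a' : Fin m → ℕ) (K : ∀ i, Matrix (Fin (a' i)) (Fin a) ℂ)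
      (hK : ∑ i, (K i).conjTranspose * K i = 1)
      (N : ∀ i, Fin n → Op (a' i) b) (hN : ∀ i, IsLOCC (N i)) :
      IsLOCC fun k => ∑ i, (K i ⊗ₖ (1 : Matrix (Fin b) (Fin b) ℂ)).conjTranspose * N i k *
        (K i ⊗ₖ (1 : Matrix (Fin b) (Fin b) ℂ))
  | bob {a b m : ℕ} (b' : Fin m → ℕ) (K : ∀ i, Matrix (Fin (b' i)) (Fin b) ℂ)
      (hK : ∑ i, (K i).conjTranspose * K i = 1)
      (N : ∀ i, Fin n → Op a (b' i)) (hN : ∀ i, IsLOCC (N i)) :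
      IsLOCC fun k => ∑ i, ((1 : Matrix (Fin a) (Fin a) ℂ) ⊗ₖ K i).conjTranspose * N i k *
        ((1 : Matrix (Fin a) (Fin a) ℂ) ⊗ₖ K i)

/-- The LOCC-accessible information of an ensemble: the supremum, over all LOCC measurements, of
the mutual information between the label and the measurement outcome. -/
def accessibleInfoLOCC {X : Type*} {a b : ℕ} (E : Ensemble X a b) : ℝ≥0∞ :=
  ⨆ (n : ℕ) (M : Fin n → Op a b) (_ : IsLOCC M), mutualInfo E.p fun x => outcomeLaw M (E.ρ x)

/-- The unit sphere of `ℂ^d`. -/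
abbrev UnitSphere (d : ℕ) : Type := Metric.sphere (0 : EuclideanSpace ℂ (Fin d)) 1

/-- The uniform probability measure on the unit sphere of `ℂ^d`: normalised surface measure. -/
def uniformSphere (d : ℕ) : Measure (UnitSphere d) :=
  ((volume : Measure (EuclideanSpace ℂ (Fin d))).toSphere Set.univ)⁻¹ •
    (volume : Measure (EuclideanSpace ℂ (Fin d))).toSphere

/-- The projector `|φ⟩⟨φ|`. -/
def proj {d : ℕ} (φ : UnitSphere d) : Matrix (Fin d) (Fin d) ℂ :=
  Matrix.vecMulVec (fun i => φ.1 i) (star fun i => φ.1 i)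

/-- The law of the outcome when the tensor product `U_A ⊗ U_B` of the two local uniform POVMs
`a |φ⟩⟨φ| dφ` and `b |ψ⟩⟨ψ| dψ` is measured on `ρ`. -/
def isotropicLaw {a b : ℕ} (ρ : Op a b) : Measure (UnitSphere a × UnitSphere b) :=
  ((uniformSphere a).prod (uniformSphere b)).withDensity fun z =>
    ENNReal.ofReal (ρ * (((a : ℂ) • proj z.1) ⊗ₖ ((b : ℂ) • proj z.2))).trace.re

/-- The mutual information `I(X : U_A ⊗ U_B)`. -/
def isotropicInfo {X : Type*} {a b : ℕ} (E : Ensemble X a b) : ℝ≥0∞ :=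
  mutualInfo E.p fun x => isotropicLaw (E.ρ x)

/-- The LOCC-subentropy of `ρ`: the infimum of the LOCC-accessible information over all discrete
(finite or countably infinite) pure-state ensembles with average `ρ`. -/
def subentropyLOCC {a b : ℕ} (ρ : Op a b) : ℝ≥0∞ :=
  ⨅ (X : Type) (_ : Countable X) (E : Ensemble X a b) (_ : ∀ x, IsPure (E.ρ x))
    (_ : E.average = ρ), accessibleInfoLOCC E

end LOCCInfo

end

/-! The information between label and outcome is the average `∑ p_x D(P_x ‖ P)` of relative
entropies (`mutualInfo_withDensity`). `pinsker` bounds each term below by half the squared L¹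
distance of `P_x` and `P`, which is the L¹ norm of the density attached to the Hermitian operator `Δ
= ρ_x - ρ`. By the variance identity `hasSum_frobSq_sub`, the averaged squared Hilbert–Schmidt norm
of `Δ` is exactly the drop in linear entropy. So the second inequality reduces to
`frobSq_le_integral_abs_isoDensity`: `‖Δ‖₂² ≤ 144 · (L¹ norm)²`. Pinsker then yields the constant
`1/288`, and `1/306` is weaker.

The L¹ estimate is the fourth-moment method: if `∫ F⁴ ≤ C (∫ F²)²`, then `∫ F² ≤ C (∫ |F|)²`. For
one quadratic form on the sphere, unitary invariance and polar coordinates reduce the moments to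
those of a weighted sum of independent exponential variables, where the fourth moment is at most 12
times the squared second. Such bounds multiply over product spaces (`integral_pow_four_prod_le`),
hence `144 = 12²`. The second moment itself dominates `‖Δ‖₂²` up to dimension factors, which cancel.

For the first inequality, the continuous POVM must be replaced by finite ones. Cut both spheres into
small cells; the coarse-grained product POVM is LOCC, Bob's measurement not even depending on
Alice's outcome. Data processing goes the wrong way here, so the isotropic information is recovered
as a lower limit: the cell densities converge almost everywhere, and Fatou applies over outcomes and
over labels.

Pure states have zero linear entropy, so the subentropy bound follows by chaining the two
inequalities for each pure-state ensemble. -/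

noncomputable section

namespace LOCCInfo

/-! ### Gaussian moments of diagonal quadratic forms -/

/-- The density of the standard Gaussian probability measure on `ℂ`. -/
def gaussianWeight (z : ℂ) : ℝ := Real.pi⁻¹ * Real.exp (-‖z‖ ^ 2)

/-- Under the standard complex Gaussian, `‖z‖²` is exponential of mean one, whose moments are
factorials. -/
lemma integral_pow_mul_gaussianWeight (c : ℝ) (j : ℕ) :
    ∫ z : ℂ, (c * ‖z‖ ^ 2) ^ j * gaussianWeight z = c ^ j * j.factorial := by
  have h := Complex.integral_rpow_mul_exp_neg_rpow (p := 2) (q := ((2 * j : ℕ) : ℝ)) (by norm_num)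
    (by have : (0 : ℝ) ≤ ((2 * j : ℕ) : ℝ) := by positivity
        linarith)
  have e : ∀ z : ℂ, (c * ‖z‖ ^ 2) ^ j * gaussianWeight z =
      (c ^ j * Real.pi⁻¹) * (‖z‖ ^ (((2 * j : ℕ) : ℝ)) * Real.exp (-‖z‖ ^ (2 : ℝ))) := by
    intro z
    rw [Real.rpow_natCast, show ‖z‖ ^ (2 : ℝ) = ‖z‖ ^ 2 by exact_mod_cast Real.rpow_natCast _ 2,
      gaussianWeight, mul_pow, pow_mul]
    ring
  simp_rw [e]
  rw [integral_const_mul, h, show (((2 * j : ℕ) : ℝ) + 2) / 2 = (j : ℝ) + 1 by push_cast; ring,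
    Real.Gamma_nat_eq_factorial]
  field_simp

lemma integrable_pow_mul_gaussianWeight (c : ℝ) (j : ℕ) :
    Integrable fun z : ℂ => (c * ‖z‖ ^ 2) ^ j * gaussianWeight z := by
  have h1 : Integrable fun z : ℂ => (1 * ‖z‖ ^ 2) ^ j * gaussianWeight z := by
    -- A non-integrable function has Bochner integral zero by convention, whereas this integral is
    -- `j! ≠ 0`.
    by_contra h
    have := integral_pow_mul_gaussianWeight 1 j
    rw [integral_undef h] at this
    simp [eq_comm, Nat.factorial_ne_zero] at this
  refine (h1.const_mul (c ^ j)).congr (ae_of_all _ fun z => ?_)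
  simp only [one_mul, mul_pow]
  ring

lemma integrable_add_pow_mul_prod {α β : Type*} [MeasurableSpace α] [MeasurableSpace β]
    {μ : Measure α} {ν : Measure β} {X u : α → ℝ} {Y v : β → ℝ}
    (hX : ∀ j : ℕ, Integrable (fun x => X x ^ j * u x) μ)
    (hY : ∀ j : ℕ, Integrable (fun y => Y y ^ j * v y) ν) (n : ℕ) :
    Integrable (fun z : α × β => (X z.1 + Y z.2) ^ n * (u z.1 * v z.2)) (μ.prod ν) := by
  simp_rw [add_pow, Finset.sum_mul]
  refine integrable_finsetSum _ fun j _ => ?_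
  refine (((hX j).mul_prod (hY (n - j))).const_mul (n.choose j : ℝ)).congr
    (ae_of_all _ fun z => ?_)
  simp only
  ring

lemma integral_add_pow_mul_prod {α β : Type*} [MeasurableSpace α] [MeasurableSpace β]
    {μ : Measure α} {ν : Measure β} [SFinite μ] [SFinite ν] {X u : α → ℝ} {Y v : β → ℝ}
    (hX : ∀ j : ℕ, Integrable (fun x => X x ^ j * u x) μ)
    (hY : ∀ j : ℕ, Integrable (fun y => Y y ^ j * v y) ν) (n : ℕ) :
    ∫ z : α × β, (X z.1 + Y z.2) ^ n * (u z.1 * v z.2) ∂μ.prod ν =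
      ∑ j ∈ Finset.range (n + 1),
        (∫ x, X x ^ j * u x ∂μ) * (∫ y, Y y ^ (n - j) * v y ∂ν) * n.choose j := by
  simp_rw [add_pow, Finset.sum_mul]
  have e : ∀ j : ℕ, ∀ z : α × β, X z.1 ^ j * Y z.2 ^ (n - j) * (n.choose j : ℝ) * (u z.1 * v z.2) =
      (n.choose j : ℝ) * ((X z.1 ^ j * u z.1) * (Y z.2 ^ (n - j) * v z.2)) := by
    intro j z; ring
  simp_rw [e]
  rw [integral_finsetSum]
  · refine Finset.sum_congr rfl fun j _ => ?_
    rw [integral_const_mul,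
      integral_prod_mul (fun x => X x ^ j * u x) (fun y => Y y ^ (n - j) * v y)]
    ring
  · exact fun j _ => ((hX j).mul_prod (hY (n - j))).const_mul _

/-- The Gaussian moment `∫ (∑ᵢ lᵢ |zᵢ|²)ʲ` of a diagonal quadratic form. -/
def diagMoment {n : ℕ} (l : Fin n → ℝ) (j : ℕ) : ℝ :=
  ∫ z : Fin n → ℂ, (∑ i, l i * ‖z i‖ ^ 2) ^ j * ∏ i, gaussianWeight (z i)

lemma piFinSuccAbove_zero_symm {n : ℕ} (w : ℂ × (Fin n → ℂ)) :
    (MeasurableEquiv.piFinSuccAbove (fun _ : Fin (n + 1) => ℂ) 0).symm w =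
      Fin.cons w.1 w.2 := by
  simp [MeasurableEquiv.piFinSuccAbove, Fin.insertNthEquiv]

lemma integral_piFinSucc {n : ℕ} (f : (Fin (n + 1) → ℂ) → ℝ) :
    ∫ z : Fin (n + 1) → ℂ, f z = ∫ w : ℂ × (Fin n → ℂ), f (Fin.cons w.1 w.2) := by
  rw [← (volume_preserving_piFinSuccAbove (fun _ : Fin (n + 1) => ℂ) 0).symm.integral_comp'
    (g := f)]
  simp only [piFinSuccAbove_zero_symm]

lemma integrable_piFinSucc {n : ℕ} {f : (Fin (n + 1) → ℂ) → ℝ}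
    (hf : Integrable fun w : ℂ × (Fin n → ℂ) => f (Fin.cons w.1 w.2)) : Integrable f := by
  rw [← (volume_preserving_piFinSuccAbove (fun _ : Fin (n + 1) => ℂ) 0).symm.integrable_comp_emb
    (MeasurableEquiv.measurableEmbedding _)]
  simpa only [Function.comp_def, piFinSuccAbove_zero_symm] using hf

lemma integrable_diagMoment {n : ℕ} (l : Fin n → ℝ) (j : ℕ) :
    Integrable fun z : Fin n → ℂ => (∑ i, l i * ‖z i‖ ^ 2) ^ j * ∏ i, gaussianWeight (z i) := by
  induction n generalizing j with
  | zero =>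
    simp only [Finset.univ_eq_empty, Finset.sum_empty, Finset.prod_empty]
    rw [Measure.volume_pi_eq_dirac 0]
    exact integrable_const _
  | succ n ih =>
    refine integrable_piFinSucc ?_
    simp only [Fin.sum_univ_succ, Fin.prod_univ_succ, Fin.cons_zero, Fin.cons_succ]
    exact integrable_add_pow_mul_prod (X := fun z : ℂ => l 0 * ‖z‖ ^ 2)
      (integrable_pow_mul_gaussianWeight (l 0))
      (fun j => ih (fun i => l i.succ) j) j

lemma diagMoment_succ {n : ℕ} (l : Fin (n + 1) → ℝ) (j : ℕ) :
    diagMoment l j = ∑ k ∈ Finset.range (j + 1),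
      (l 0 ^ k * k.factorial) * diagMoment (fun i => l i.succ) (j - k) * j.choose k := by
  rw [diagMoment, integral_piFinSucc]
  simp only [Fin.sum_univ_succ, Fin.prod_univ_succ, Fin.cons_zero, Fin.cons_succ]
  have := integral_add_pow_mul_prod (X := fun z : ℂ => l 0 * ‖z‖ ^ 2) (μ := volume)
      (integrable_pow_mul_gaussianWeight (l 0))
      (fun j => integrable_diagMoment (fun i => l i.succ) j) j
  simp only [integral_pow_mul_gaussianWeight] at this
  exact this

lemma diagMoment_zero_left (l : Fin 0 → ℝ) (j : ℕ) : diagMoment l j = 0 ^ j := by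
  rw [diagMoment, Measure.volume_pi_eq_dirac 0]
  simp

/-- The `j`-th moment is `j!` times the complete homogeneous symmetric polynomial of `l`; in power
sums, its coefficients count permutations by cycle type. -/
lemma diagMoment_values {n : ℕ} (l : Fin n → ℝ) :
    diagMoment l 0 = 1 ∧ diagMoment l 1 = ∑ i, l i ∧
    diagMoment l 2 = (∑ i, l i) ^ 2 + ∑ i, l i ^ 2 ∧
    diagMoment l 3 = (∑ i, l i) ^ 3 + 3 * (∑ i, l i) * (∑ i, l i ^ 2) + 2 * ∑ i, l i ^ 3 ∧
    diagMoment l 4 = (∑ i, l i) ^ 4 + 6 * (∑ i, l i) ^ 2 * (∑ i, l i ^ 2) +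
      3 * (∑ i, l i ^ 2) ^ 2 + 8 * (∑ i, l i) * (∑ i, l i ^ 3) + 6 * ∑ i, l i ^ 4 := by
  induction n with
  | zero => simp [diagMoment_zero_left]
  | succ n ih =>
    obtain ⟨h0, h1, h2, h3, h4⟩ := ih (fun i => l i.succ)
    simp only [diagMoment_succ l, Fin.sum_univ_succ, Finset.sum_range_succ, Finset.sum_range_zero,
      h0, h1, h2, h3, h4, Nat.reduceAdd, Nat.reduceSub, tsub_zero, tsub_self]
    norm_num [Nat.factorial, Nat.choose]
    refine ⟨by ring, by ring, by ring, by ring⟩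

lemma diagMoment_two {n : ℕ} (l : Fin n → ℝ) :
    diagMoment l 2 = (∑ i, l i) ^ 2 + ∑ i, l i ^ 2 := (diagMoment_values l).2.2.1

lemma diagMoment_four_le {n : ℕ} (l : Fin n → ℝ) :
    diagMoment l 4 ≤ 12 * diagMoment l 2 ^ 2 := by
  rw [(diagMoment_values l).2.2.2.2, diagMoment_two]
  set s := ∑ i, l i
  set q := ∑ i, l i ^ 2 with hq
  set c := ∑ i, l i ^ 3 with hc
  set f := ∑ i, l i ^ 4 with hf
  have hq0 : 0 ≤ q := Finset.sum_nonneg fun i _ => sq_nonneg _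
  have hfq : f ≤ q ^ 2 := by
    have := Finset.sum_sq_le_sq_sum_of_nonneg (s := Finset.univ) (f := fun i => l i ^ 2)
      (fun i _ => sq_nonneg (l i))
    simpa [hf, hq, ← pow_mul] using this
  have hcq : c ^ 2 ≤ q * f := by
    have := Finset.sum_mul_sq_le_sq_mul_sq Finset.univ l (fun i => l i ^ 2)
    simpa [hf, hq, hc, ← pow_mul, ← pow_succ'] using this
  have hc3 : c ^ 2 ≤ q ^ 3 := by nlinarith
  -- The cubic term is the only one of indefinite sign. The split 18, 3 is what remains after
  -- comparing with `12 (s² + q)²`: `24 - 6 = 18` for `s² q` and `12 - 3 - 6 = 3` for `q²`.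
  have key : 8 * s * c ≤ 18 * s ^ 2 * q + 3 * q ^ 2 := by
    refine abs_le_of_sq_le_sq' ?_ (by positivity) |>.2
    nlinarith [mul_nonneg (sq_nonneg s) (sub_nonneg.2 hc3), sq_nonneg (s ^ 2 * q),
      mul_nonneg (sq_nonneg s) (pow_nonneg hq0 3), sq_nonneg (q ^ 2)]
  nlinarith [sq_nonneg (s ^ 2)]

/-! ### Moments of quadratic forms over the unit sphere -/

/-- The quadratic form `⟨v|M|v⟩`. -/
def quadForm {d : ℕ} (M : Matrix (Fin d) (Fin d) ℂ) (v : Fin d → ℂ) : ℝ :=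
  (star v ⬝ᵥ M.mulVec v).re

lemma continuous_quadForm {d : ℕ} (M : Matrix (Fin d) (Fin d) ℂ) : Continuous (quadForm M) := by
  unfold quadForm
  fun_prop

lemma trace_mul_vecMulVec {n : Type*} [Fintype n] (M : Matrix n n ℂ) (v : n → ℂ) :
    (M * Matrix.vecMulVec v (star v)).trace = star v ⬝ᵥ M.mulVec v := by
  rw [Matrix.mul_vecMulVec, Matrix.trace_vecMulVec, dotProduct_comm]

lemma trace_mul_proj {d : ℕ} (M : Matrix (Fin d) (Fin d) ℂ) (φ : UnitSphere d) :
    (M * proj φ).trace.re = quadForm M φ.1.ofLp := by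
  rw [proj, trace_mul_vecMulVec]
  rfl

/-- Polar coordinates: homogeneity separates the angular from the radial variable. -/
lemma integral_mul_exp_neg_norm_sq {E : Type*} [NormedAddCommGroup E] [NormedSpace ℝ E]
    [MeasurableSpace E] [BorelSpace E] [FiniteDimensional ℝ E] [Nontrivial E] (μ : Measure E)
    [μ.IsAddHaarMeasure] {g : E → ℝ} {k : ℕ}
    (hg : ∀ r : ℝ, 0 < r → ∀ v, g (r • v) = r ^ k * g v) :
    ∫ v : E, g v * Real.exp (-‖v‖ ^ 2) ∂μ =
      (∫ φ : Metric.sphere (0 : E) 1, g φ.1 ∂μ.toSphere) *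
        ∫ r : Set.Ioi (0 : ℝ), r.1 ^ k * Real.exp (-r.1 ^ 2)
          ∂Measure.volumeIoiPow (Module.finrank ℝ E - 1) := by
  calc ∫ v : E, g v * Real.exp (-‖v‖ ^ 2) ∂μ
      = ∫ v : ({0}ᶜ : Set E), g v.1 * Real.exp (-‖v.1‖ ^ 2) ∂μ.comap (↑) := by
        rw [integral_subtype_comap (measurableSet_singleton _).compl
          fun v : E => g v * Real.exp (-‖v‖ ^ 2), restrict_compl_singleton]
    _ = ∫ z : Metric.sphere (0 : E) 1 × Set.Ioi (0 : ℝ),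
          g z.1.1 * (z.2.1 ^ k * Real.exp (-z.2.1 ^ 2))
          ∂μ.toSphere.prod (Measure.volumeIoiPow (Module.finrank ℝ E - 1)) := by
        rw [← μ.measurePreserving_homeomorphUnitSphereProd.integral_comp
          (Homeomorph.measurableEmbedding _)]
        refine integral_congr_ae (ae_of_all _ fun v => ?_)
        have hv : 0 < ‖v.1‖ := norm_pos_iff.2 v.2
        have e : v.1 = ‖v.1‖ • ((homeomorphUnitSphereProd E v).1 : E) := by
          simp [smul_smul, hv.ne']
        have e2 : g v.1 = ‖v.1‖ ^ k * g ((homeomorphUnitSphereProd E v).1 : E) := by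
          conv_lhs => rw [e]
          exact hg _ hv _
        simp only [homeomorphUnitSphereProd_apply_snd_coe]
        rw [e2]
        ring
    _ = _ := integral_prod_mul (fun φ : Metric.sphere (0 : E) 1 => g φ.1)
      (fun r : Set.Ioi (0 : ℝ) => r.1 ^ k * Real.exp (-r.1 ^ 2))

lemma integral_uniformSphere_mul {d : ℕ} [NeZero d] (f : EuclideanSpace ℂ (Fin d) → ℝ) (k : ℕ)
    (hf : ∀ r : ℝ, 0 < r → ∀ v, f (r • v) = r ^ k * f v) :
    (∫ φ, f φ.1 ∂uniformSphere d) *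
        ∫ v : EuclideanSpace ℂ (Fin d), ‖v‖ ^ k * Real.exp (-‖v‖ ^ 2) =
      ∫ v : EuclideanSpace ℂ (Fin d), f v * Real.exp (-‖v‖ ^ 2) := by
  rw [integral_mul_exp_neg_norm_sq _ hf,
    integral_mul_exp_neg_norm_sq _ (g := fun v => ‖v‖ ^ k) fun r hr v => by
      rw [norm_smul, Real.norm_of_nonneg hr.le, mul_pow]]
  have hne : ((volume : Measure (EuclideanSpace ℂ (Fin d))).toSphere Set.univ).toReal ≠ 0 :=
    (ENNReal.toReal_pos (by
      rw [Ne, Measure.measure_univ_eq_zero]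
      exact Measure.toSphere_ne_zero _) (measure_ne_top _ _)).ne'
  rw [uniformSphere, integral_smul_measure]
  simp only [norm_eq_of_mem_sphere, one_pow, integral_const, smul_eq_mul, mul_one,
    ENNReal.toReal_inv, Measure.real]
  field_simp

/-- The constant combines the ratio of two Haar measures with the Gaussian normalisation `π ^ d`.
Its value is irrelevant: it does not depend on `l` or `j`, so it cancels in moment ratios. -/
lemma exists_integral_diag_eq_diagMoment (d : ℕ) : ∃ c : ℝ, 0 < c ∧ ∀ (l : Fin d → ℝ) (j : ℕ),
    ∫ v : EuclideanSpace ℂ (Fin d), (∑ i, l i * ‖v i‖ ^ 2) ^ j * Real.exp (-‖v‖ ^ 2) =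
      c * diagMoment l j := by
  set L := (PiLp.continuousLinearEquiv 2 ℝ (fun _ : Fin d => ℂ)).symm
  set ν := (volume : Measure (Fin d → ℂ)).map L
  have : ν.IsAddHaarMeasure := L.isAddHaarMeasure_map _
  have hν := Measure.isAddLeftInvariant_eq_smul (volume : Measure (EuclideanSpace ℂ (Fin d))) ν
  set κ := (volume : Measure (EuclideanSpace ℂ (Fin d))).addHaarScalarFactor ν
  have hκ : 0 < κ := Measure.addHaarScalarFactor_pos_of_isAddHaarMeasure _ _
  refine ⟨κ * Real.pi ^ d, by positivity, fun l j => ?_⟩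
  have hmap : ∀ f : EuclideanSpace ℂ (Fin d) → ℝ, ∫ v, f v ∂ν = ∫ z, f (L z) :=
    fun f => L.toHomeomorph.measurableEmbedding.integral_map f
  rw [hν, integral_smul_nnreal_measure, hmap, diagMoment, NNReal.smul_def, smul_eq_mul,
    mul_assoc, ← integral_const_mul (Real.pi ^ d)]
  congr 1
  refine integral_congr_ae (ae_of_all _ fun z => ?_)
  have h2 : ‖L z‖ ^ 2 = ∑ i, ‖z i‖ ^ 2 := EuclideanSpace.norm_sq_eq _
  have h3 : ∀ i, (L z) i = z i := fun _ => rfl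
  simp only [h2, h3, gaussianWeight, Finset.prod_mul_distrib, Finset.prod_const,
    Finset.card_univ, Fintype.card_fin, inv_pow, ← Real.exp_sum, Finset.sum_neg_distrib]
  have := Real.pi_pos
  field_simp

lemma quadForm_eq_sum_eigenvalues {d : ℕ} {M : Matrix (Fin d) (Fin d) ℂ} (hM : M.IsHermitian)
    (v : EuclideanSpace ℂ (Fin d)) :
    quadForm M v.ofLp = ∑ i, hM.eigenvalues i * ‖hM.eigenvectorBasis.repr v i‖ ^ 2 := by
  have hU : ∀ i, ((hM.eigenvectorUnitary : Matrix (Fin d) (Fin d) ℂ).conjTranspose.mulVec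
      v.ofLp) i = hM.eigenvectorBasis.repr v i := by
    intro i
    rw [OrthonormalBasis.repr_apply_apply]
    simp [Matrix.mulVec, dotProduct, PiLp.inner_apply, mul_comm]
  have h := hM.spectral_theorem
  rw [Unitary.conjStarAlgAut_apply] at h
  rw [quadForm]
  conv_lhs => rw [h]
  rw [← Matrix.mulVec_mulVec, ← Matrix.mulVec_mulVec, Matrix.dotProduct_mulVec,
    show Matrix.vecMul (star v.ofLp) (hM.eigenvectorUnitary : Matrix (Fin d) (Fin d) ℂ) =
      star ((hM.eigenvectorUnitary : Matrix (Fin d) (Fin d) ℂ).conjTranspose.mulVec v.ofLp) by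
      rw [Matrix.star_mulVec, Matrix.conjTranspose_conjTranspose]]
  rw [Matrix.star_eq_conjTranspose]
  simp only [dotProduct, Matrix.mulVec_diagonal, Pi.star_apply, hU, Complex.re_sum]
  refine Finset.sum_congr rfl fun i _ => ?_
  rw [Function.comp_apply, mul_left_comm, RCLike.star_def, Complex.conj_mul']
  simp [← Complex.ofReal_pow]

/-- Passing to an eigenbasis is an isometry, which preserves both volume and the Gaussian factor. -/
lemma integral_quadForm_gaussian {d : ℕ} {M : Matrix (Fin d) (Fin d) ℂ} (hM : M.IsHermitian)
    (j : ℕ) :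
    ∫ v : EuclideanSpace ℂ (Fin d), quadForm M v.ofLp ^ j * Real.exp (-‖v‖ ^ 2) =
      ∫ v : EuclideanSpace ℂ (Fin d),
        (∑ i, hM.eigenvalues i * ‖v i‖ ^ 2) ^ j * Real.exp (-‖v‖ ^ 2) := by
  let e : EuclideanSpace ℂ (Fin d) ≃ₗᵢ[ℝ] EuclideanSpace ℂ (Fin d) :=
    { hM.eigenvectorBasis.repr.toLinearEquiv.restrictScalars ℝ with
      norm_map' := hM.eigenvectorBasis.repr.norm_map }
  rw [← e.measurePreserving.integral_comp e.toHomeomorph.measurableEmbedding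
    fun v => (∑ i, hM.eigenvalues i * ‖v i‖ ^ 2) ^ j * Real.exp (-‖v‖ ^ 2)]
  refine integral_congr_ae (ae_of_all _ fun v => ?_)
  simp only [quadForm_eq_sum_eigenvalues hM, e.norm_map]
  rfl

lemma quadForm_smul {d : ℕ} (M : Matrix (Fin d) (Fin d) ℂ) (r : ℝ) (v : Fin d → ℂ) :
    quadForm M (r • v) = r ^ 2 * quadForm M v := by
  have : star (r • v) = r • star v := by ext; simp
  simp only [quadForm, this, Matrix.mulVec_smul, dotProduct_smul, smul_dotProduct,
    Complex.real_smul, Complex.re_ofReal_mul]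
  ring

lemma integral_quadForm_pow {d : ℕ} [NeZero d] {M : Matrix (Fin d) (Fin d) ℂ}
    (hM : M.IsHermitian) (j : ℕ) :
    (∫ φ, quadForm M φ.1.ofLp ^ j ∂uniformSphere d) * diagMoment (fun _ : Fin d => 1) j =
      diagMoment hM.eigenvalues j := by
  obtain ⟨c, hc, h⟩ := exists_integral_diag_eq_diagMoment d
  have h1 := integral_uniformSphere_mul
    (fun v : EuclideanSpace ℂ (Fin d) => quadForm M v.ofLp ^ j) (2 * j) fun r _ v => by
      rw [WithLp.ofLp_smul, quadForm_smul, mul_pow, pow_mul]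
  rw [integral_quadForm_gaussian hM, h] at h1
  have h2 := h (fun _ => 1) j
  simp only [one_mul, ← EuclideanSpace.norm_sq_eq, ← pow_mul] at h2
  rw [h2] at h1
  apply mul_left_cancel₀ hc.ne'
  linarith

lemma sum_eigenvalues_eq {d : ℕ} {M : Matrix (Fin d) (Fin d) ℂ} (hM : M.IsHermitian) :
    ∑ i, hM.eigenvalues i = M.trace.re := by
  rw [hM.trace_eq_sum_eigenvalues]
  simp

lemma sum_eigenvalues_sq_eq {d : ℕ} {M : Matrix (Fin d) (Fin d) ℂ} (hM : M.IsHermitian) :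
    ∑ i, hM.eigenvalues i ^ 2 = (M * M).trace.re := by
  have h := hM.spectral_theorem
  have h2 : M * M = (Unitary.conjStarAlgAut ℂ (Matrix (Fin d) (Fin d) ℂ)) hM.eigenvectorUnitary
      (Matrix.diagonal (RCLike.ofReal ∘ hM.eigenvalues) *
        Matrix.diagonal (RCLike.ofReal ∘ hM.eigenvalues)) := by
    rw [map_mul, ← h]
  rw [h2, Unitary.conjStarAlgAut_apply, Matrix.trace_mul_cycle, Unitary.coe_star_mul_self, one_mul,
    Matrix.diagonal_mul_diagonal, Matrix.trace_diagonal]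
  simp [pow_two]

theorem integral_quadForm {d : ℕ} [NeZero d] {M : Matrix (Fin d) (Fin d) ℂ}
    (hM : M.IsHermitian) :
    (∫ φ, quadForm M φ.1.ofLp ∂uniformSphere d) * d = M.trace.re := by
  have h := integral_quadForm_pow hM 1
  simp only [(diagMoment_values _).2.1, sum_eigenvalues_eq hM] at h
  simpa using h

theorem integral_quadForm_sq {d : ℕ} [NeZero d] {M : Matrix (Fin d) (Fin d) ℂ}
    (hM : M.IsHermitian) :
    (∫ φ, quadForm M φ.1.ofLp ^ 2 ∂uniformSphere d) * (d * (d + 1)) =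
      M.trace.re ^ 2 + (M * M).trace.re := by
  have h := integral_quadForm_pow hM 2
  simp only [diagMoment_two, sum_eigenvalues_eq hM, sum_eigenvalues_sq_eq hM] at h
  rw [← h]
  simp only [Finset.sum_const, Finset.card_univ, Fintype.card_fin, nsmul_eq_mul, mul_one, one_pow]
  ring

/-- The normalisations `d(d+1)` and `d(d+1)(d+2)(d+3)` turn 12 into `12 d(d+1) / ((d+2)(d+3))`,
relaxed to `12 d / (d+1)`. This form is kept because it later cancels the factor `d(d+1)` down to
`d²`. -/
theorem integral_quadForm_pow_four_le {d : ℕ} [NeZero d] {M : Matrix (Fin d) (Fin d) ℂ}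
    (hM : M.IsHermitian) :
    (∫ φ, quadForm M φ.1.ofLp ^ 4 ∂uniformSphere d) * (d + 1) ≤
      12 * d * (∫ φ, quadForm M φ.1.ofLp ^ 2 ∂uniformSphere d) ^ 2 := by
  have h2 := integral_quadForm_pow hM 2
  have h4 := integral_quadForm_pow hM 4
  have hle := diagMoment_four_le hM.eigenvalues
  have hd : (1 : ℝ) ≤ d := by exact_mod_cast NeZero.one_le
  rw [← h2, ← h4] at hle
  simp only [(diagMoment_values _).2.2.2.2, diagMoment_two, one_pow, Finset.sum_const,
    Finset.card_univ, Fintype.card_fin, nsmul_eq_mul, mul_one] at hle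
  set x := ∫ φ, quadForm M φ.1.ofLp ^ 4 ∂uniformSphere d
  set y := ∫ φ, quadForm M φ.1.ofLp ^ 2 ∂uniformSphere d
  have hx : 0 ≤ x := integral_nonneg fun φ => by positivity
  have e1 : (d : ℝ) ^ 4 + 6 * d ^ 2 * d + 3 * d ^ 2 + 8 * d * d + 6 * d =
    d * (d + 1) * ((d + 2) * (d + 3)) := by ring
  have e2 : 12 * (y * ((d : ℝ) ^ 2 + d)) ^ 2 = d * (d + 1) * (12 * (d * (d + 1)) * y ^ 2) := by ring
  rw [e1, e2, mul_left_comm, mul_le_mul_iff_right₀ (by positivity)] at hle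
  have hd1 : 0 < (d : ℝ) + 1 := by positivity
  rw [← mul_le_mul_iff_left₀ hd1]
  refine le_trans ?_ (hle.trans_eq (by ring))
  nlinarith

/-! ### Moment inequalities for continuous functions on compact spaces -/

lemma integrable_of_continuous {α E : Type*} [TopologicalSpace α] [CompactSpace α]
    [MeasurableSpace α] [OpensMeasurableSpace α] [NormedAddCommGroup E]
    [SecondCountableTopologyEither α E] {μ : Measure α}
    [IsFiniteMeasure μ] {f : α → E} (hf : Continuous f) : Integrable f μ :=
  hf.integrable_of_hasCompactSupport (HasCompactSupport.of_compactSpace f)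

lemma sq_integral_mul_le {α : Type*} [MeasurableSpace α] {μ : Measure α} {f g : α → ℝ}
    (hf : Integrable (fun x => f x ^ 2) μ) (hg : Integrable (fun x => g x ^ 2) μ)
    (hfg : Integrable (fun x => f x * g x) μ) :
    (∫ x, f x * g x ∂μ) ^ 2 ≤ (∫ x, f x ^ 2 ∂μ) * ∫ x, g x ^ 2 ∂μ := by
  -- Cauchy–Schwarz by the discriminant of `t ↦ ∫ (t f + g)²`.
  have h : ∀ t : ℝ, 0 ≤ (∫ x, f x ^ 2 ∂μ) * (t * t) + (2 * ∫ x, f x * g x ∂μ) * t +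
      ∫ x, g x ^ 2 ∂μ := by
    intro t
    have e : ∫ x, (t * f x + g x) ^ 2 ∂μ = (∫ x, f x ^ 2 ∂μ) * (t * t) +
        (2 * ∫ x, f x * g x ∂μ) * t + ∫ x, g x ^ 2 ∂μ := by
      rw [← integral_const_mul, ← integral_mul_const, ← integral_mul_const, ← integral_add,
        ← integral_add]
      · refine integral_congr_ae (ae_of_all _ fun x => ?_)
        ring
      · exact (hf.mul_const _).add ((hfg.const_mul _).mul_const _)
      · exact hg
      · exact hf.mul_const _
      · exact (hfg.const_mul _).mul_const _
    rw [← e]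
    exact integral_nonneg fun x => sq_nonneg _
  have := discrim_le_zero h
  rw [discrim] at this
  nlinarith

/-- The interpolation `m₂³ ≤ m₁² m₄` replaces Hölder by the pointwise inequality `t (t - s)² (t +
2s) ≥ 0` at `t = |F|`, that is `3 s² t² ≤ 2 s³ t + t⁴`, with the optimal `s² = m₄ / m₂`. -/
lemma integral_sq_le_of_integral_pow_four_le {α : Type*} [TopologicalSpace α] [CompactSpace α]
    [MeasurableSpace α] [BorelSpace α] {μ : Measure α} [IsFiniteMeasure μ] {F : α → ℝ}
    (hF : Continuous F) {C : ℝ} (h : ∫ x, F x ^ 4 ∂μ ≤ C * (∫ x, F x ^ 2 ∂μ) ^ 2) :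
    ∫ x, F x ^ 2 ∂μ ≤ C * (∫ x, |F x| ∂μ) ^ 2 := by
  set m₂ := ∫ x, F x ^ 2 ∂μ with hm₂
  set m₄ := ∫ x, F x ^ 4 ∂μ with hm₄
  set m₁ := ∫ x, |F x| ∂μ with hm₁
  have i1 : Integrable (fun x => |F x|) μ := integrable_of_continuous (by fun_prop)
  have i2 : Integrable (fun x => F x ^ 2) μ := integrable_of_continuous (by fun_prop)
  have i4 : Integrable (fun x => F x ^ 4) μ := integrable_of_continuous (by fun_prop)
  have p2 : 0 ≤ m₂ := integral_nonneg fun x => sq_nonneg _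
  have p4 : 0 ≤ m₄ := integral_nonneg fun x => by positivity
  have p1 : 0 ≤ m₁ := integral_nonneg fun x => abs_nonneg _
  have key : ∀ s : ℝ, 0 ≤ s → 3 * s ^ 2 * m₂ ≤ 2 * s ^ 3 * m₁ + m₄ := by
    intro s hs
    rw [hm₂, hm₄, hm₁, ← integral_const_mul, ← integral_const_mul,
      ← integral_add (i1.const_mul _) i4]
    refine integral_mono (i2.const_mul _) ((i1.const_mul _).add i4) fun x => ?_
    have e2 : F x ^ 2 = |F x| ^ 2 := (sq_abs _).symm
    have e4 : F x ^ 4 = |F x| ^ 4 := by rw [pow_abs, abs_of_nonneg (by positivity)]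
    simp only
    rw [e2, e4]
    have hx := abs_nonneg (F x)
    have : 0 ≤ |F x| * (|F x| - s) ^ 2 * (|F x| + 2 * s) := by positivity
    nlinarith
  rcases p2.eq_or_lt with h0 | h0
  · have hm40 : m₄ ≤ 0 := by simpa [← h0] using h
    have hF0 : m₁ = 0 := by
      have : F =ᵐ[μ] 0 := by
        have := (integral_eq_zero_iff_of_nonneg (fun x => sq_nonneg (F x)) i2).1 h0.symm
        filter_upwards [this] with x hx
        simpa using hx
      rw [hm₁, integral_congr_ae (g := fun _ => 0), integral_zero]
      filter_upwards [this] with x hx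
      simp [hx]
    simp [← h0, hF0]
  · have p4' : 0 < m₄ := by
      by_contra hcon
      have h4 : m₄ = 0 := le_antisymm (not_lt.1 hcon) p4
      -- If `m₄ = 0`, any small `s > 0` contradicts `3 m₂ ≤ 2 s m₁`; this one satisfies `s m₁ ≤ m₂`.
      have := key (m₂ / (m₁ + m₂)) (by positivity)
      rw [h4, add_zero] at this
      have hs : 0 < m₂ / (m₁ + m₂) := by positivity
      have h3 : 3 * m₂ ≤ 2 * (m₂ / (m₁ + m₂)) * m₁ := by
        have h5 : 0 < (m₂ / (m₁ + m₂)) ^ 2 := by positivity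
        nlinarith
      have : m₂ / (m₁ + m₂) * m₁ ≤ m₂ := by
        rw [div_mul_eq_mul_div, div_le_iff₀ (by positivity)]
        nlinarith
      linarith
    set s := Real.sqrt (m₄ / m₂) with hs
    have hs2 : s ^ 2 = m₄ / m₂ := Real.sq_sqrt (by positivity)
    have hs0 : 0 < s := Real.sqrt_pos.2 (by positivity)
    have hk := key s hs0.le
    have e : m₄ = s ^ 2 * m₂ := by rw [hs2]; field_simp
    have h6 : m₂ ≤ s * m₁ := by
      have : 0 < s ^ 2 := by positivity
      rw [e] at hk
      nlinarith
    have h7 : m₂ ^ 2 ≤ s ^ 2 * m₁ ^ 2 := by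
      rw [← mul_pow]
      exact pow_le_pow_left₀ p2 h6 2
    have h8 : s ^ 2 ≤ C * m₂ := by
      rw [hs2, div_le_iff₀ h0]
      linarith
    have h9 : m₂ ^ 2 ≤ C * m₂ * m₁ ^ 2 := h7.trans (by gcongr)
    nlinarith

section Compact

variable {α β : Type*} [TopologicalSpace α] [CompactSpace α] [SecondCountableTopology α]
  [MeasurableSpace α] [BorelSpace α] [TopologicalSpace β] [CompactSpace β]
  [SecondCountableTopology β] [MeasurableSpace β] [BorelSpace β] {μ : Measure α} {ν : Measure β}
  [IsFiniteMeasure μ] [IsFiniteMeasure ν]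

/-- After the bound in `x`, the square of `∫ F(x,y)² dx` is written as an integral over two copies
`x, x'`. Exchanging integrals leaves `∫ F(x,y)² F(x',y)² dy`, controlled by Cauchy–Schwarz and the
bound in `y`. -/
lemma integral_pow_four_prod_le {F : α × β → ℝ} (hF : Continuous F) {A B : ℝ} (hA : 0 ≤ A)
    (hB : 0 ≤ B)
    (h1 : ∀ y, ∫ x, F (x, y) ^ 4 ∂μ ≤ A * (∫ x, F (x, y) ^ 2 ∂μ) ^ 2)
    (h2 : ∀ x, ∫ y, F (x, y) ^ 4 ∂ν ≤ B * (∫ y, F (x, y) ^ 2 ∂ν) ^ 2) :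
    ∫ z, F z ^ 4 ∂μ.prod ν ≤ A * B * (∫ z, F z ^ 2 ∂μ.prod ν) ^ 2 := by
  have hint : Integrable (fun z : β × α × α => F (z.2.1, z.1) ^ 2 * F (z.2.2, z.1) ^ 2)
      (ν.prod (μ.prod μ)) := integrable_of_continuous (by fun_prop)
  have hF4 : Integrable (fun z : α × β => F z ^ 4) (μ.prod ν) :=
    integrable_of_continuous (by fun_prop)
  have hF2 : Integrable (fun z : α × β => F z ^ 2) (μ.prod ν) :=
    integrable_of_continuous (by fun_prop)
  have hsq : ∀ y, (∫ x, F (x, y) ^ 2 ∂μ) ^ 2 =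
      ∫ w : α × α, F (w.1, y) ^ 2 * F (w.2, y) ^ 2 ∂μ.prod μ := fun y => by
    rw [integral_prod_mul (fun x => F (x, y) ^ 2) (fun x => F (x, y) ^ 2), sq]
  have hcs : ∀ w : α × α, ∫ y, F (w.1, y) ^ 2 * F (w.2, y) ^ 2 ∂ν ≤
      B * ((∫ y, F (w.1, y) ^ 2 ∂ν) * ∫ y, F (w.2, y) ^ 2 ∂ν) := by
    intro w
    have := sq_integral_mul_le (μ := ν) (f := fun y => F (w.1, y) ^ 2)
      (g := fun y => F (w.2, y) ^ 2) (integrable_of_continuous (by fun_prop))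
      (integrable_of_continuous (by fun_prop)) (integrable_of_continuous (by fun_prop))
    simp only [← pow_mul] at this
    have p1 : 0 ≤ ∫ y, F (w.1, y) ^ 2 ∂ν := integral_nonneg fun y => sq_nonneg _
    have p2 : 0 ≤ ∫ y, F (w.2, y) ^ 2 ∂ν := integral_nonneg fun y => sq_nonneg _
    refine abs_le_of_sq_le_sq' (this.trans ?_) (by positivity) |>.2
    refine (mul_le_mul (h2 w.1) (h2 w.2) (integral_nonneg fun y => by positivity)
      (by positivity)).trans_eq (by ring)
  calc ∫ z, F z ^ 4 ∂μ.prod ν = ∫ y, ∫ x, F (x, y) ^ 4 ∂μ ∂ν := integral_prod_symm _ hF4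
    _ ≤ ∫ y, A * ∫ w : α × α, F (w.1, y) ^ 2 * F (w.2, y) ^ 2 ∂μ.prod μ ∂ν := by
        refine integral_mono hF4.integral_prod_right (hint.integral_prod_left.const_mul A)
          fun y => ?_
        rw [← hsq]
        exact h1 y
    _ = A * ∫ w : α × α, ∫ y, F (w.1, y) ^ 2 * F (w.2, y) ^ 2 ∂ν ∂μ.prod μ := by
        rw [integral_const_mul, integral_integral_swap hint]
    _ ≤ A * ∫ w : α × α, B * ((∫ y, F (w.1, y) ^ 2 ∂ν) * ∫ y, F (w.2, y) ^ 2 ∂ν) ∂μ.prod μ := by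
        refine mul_le_mul_of_nonneg_left (integral_mono hint.integral_prod_right
          ((hF2.integral_prod_left.mul_prod hF2.integral_prod_left).const_mul B) hcs) hA
    _ = A * B * (∫ z, F z ^ 2 ∂μ.prod ν) ^ 2 := by
        rw [integral_const_mul, integral_prod_mul (fun x => ∫ y, F (x, y) ^ 2 ∂ν)
          (fun x => ∫ y, F (x, y) ^ 2 ∂ν), integral_prod _ hF2]
        ring

end Compact

/-! ### The distinguishability norm of the product of the uniform POVMs -/

instance {d : ℕ} [NeZero d] : IsProbabilityMeasure (uniformSphere d) where
  measure_univ := by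
    rw [uniformSphere, Measure.smul_apply, smul_eq_mul]
    refine ENNReal.inv_mul_cancel ?_ (measure_ne_top _ _)
    rw [Ne, Measure.measure_univ_eq_zero]
    exact Measure.toSphere_ne_zero _

/-- The squared Hilbert–Schmidt norm. -/
def frobSq {n : Type*} [Fintype n] (M : Matrix n n ℂ) : ℝ := ∑ i, ∑ j, ‖M i j‖ ^ 2

lemma frobSq_nonneg {n : Type*} [Fintype n] (M : Matrix n n ℂ) : 0 ≤ frobSq M :=
  Finset.sum_nonneg fun _ _ => Finset.sum_nonneg fun _ _ => sq_nonneg _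

lemma trace_mul_conjTranspose_self_re {n : Type*} [Fintype n] (M : Matrix n n ℂ) :
    (M * M.conjTranspose).trace.re = frobSq M := by
  simp [Matrix.trace, Matrix.mul_apply, frobSq, Complex.mul_conj', ← Complex.ofReal_pow]

lemma trace_mul_self_re {n : Type*} [Fintype n] {M : Matrix n n ℂ} (hM : M.IsHermitian) :
    (M * M).trace.re = frobSq M := by
  rw [← trace_mul_conjTranspose_self_re, hM.eq]

lemma frobSq_le_integral_quadForm_sq {d : ℕ} [NeZero d] {M : Matrix (Fin d) (Fin d) ℂ}
    (hM : M.IsHermitian) :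
    frobSq M ≤ (∫ φ, quadForm M φ.1.ofLp ^ 2 ∂uniformSphere d) * (d * (d + 1)) := by
  rw [integral_quadForm_sq hM, trace_mul_self_re hM]
  nlinarith [sq_nonneg M.trace.re]

lemma continuous_quadForm_sphere {d : ℕ} (M : Matrix (Fin d) (Fin d) ℂ) :
    Continuous fun φ : UnitSphere d => quadForm M φ.1.ofLp :=
  (continuous_quadForm M).comp ((PiLp.continuous_ofLp 2 _).comp continuous_subtype_val)

/-- The real and imaginary parts of `⟨v|N|v⟩` are the forms of the two Hermitian parts of `N`. The
non-Hermitian case is needed for the off-diagonal blocks of a bipartite operator. -/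
lemma norm_sq_dotProduct_mulVec {d : ℕ} (N : Matrix (Fin d) (Fin d) ℂ) (v : Fin d → ℂ) :
    ‖star v ⬝ᵥ N.mulVec v‖ ^ 2 =
      quadForm ((1 / 2 : ℂ) • (N + N.conjTranspose)) v ^ 2 +
        quadForm ((Complex.I / 2) • (N.conjTranspose - N)) v ^ 2 := by
  have h : star v ⬝ᵥ N.conjTranspose.mulVec v = star (star v ⬝ᵥ N.mulVec v) := by
    rw [← Matrix.star_dotProduct, Matrix.star_mulVec, Matrix.dotProduct_mulVec]
  simp only [quadForm, Matrix.smul_mulVec, Matrix.add_mulVec, Matrix.sub_mulVec,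
    dotProduct_smul, dotProduct_add, dotProduct_sub, h]
  set w := star v ⬝ᵥ N.mulVec v
  rw [← Complex.normSq_eq_norm_sq, Complex.normSq_apply]
  simp
  ring

lemma frobSq_le_integral_norm_sq {d : ℕ} [NeZero d] (N : Matrix (Fin d) (Fin d) ℂ) :
    frobSq N ≤ (∫ φ, ‖star φ.1.ofLp ⬝ᵥ N.mulVec φ.1.ofLp‖ ^ 2 ∂uniformSphere d) *
      (d * (d + 1)) := by
  have h1 : ((1 / 2 : ℂ) • (N + N.conjTranspose)).IsHermitian := by
    rw [Matrix.IsHermitian, Matrix.conjTranspose_smul, Matrix.conjTranspose_add,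
      Matrix.conjTranspose_conjTranspose, add_comm]
    simp
  have h2 : ((Complex.I / 2) • (N.conjTranspose - N)).IsHermitian := by
    rw [Matrix.IsHermitian, Matrix.conjTranspose_smul, Matrix.conjTranspose_sub,
      Matrix.conjTranspose_conjTranspose, ← neg_sub, smul_neg, ← neg_smul]
    congr 1
    simp [neg_div]
  have hi : ∀ M : Matrix (Fin d) (Fin d) ℂ,
      Integrable (fun φ : UnitSphere d => quadForm M φ.1.ofLp ^ 2) (uniformSphere d) :=
    fun M => integrable_of_continuous ((continuous_quadForm_sphere M).pow 2)
  simp only [norm_sq_dotProduct_mulVec]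
  rw [integral_add (hi _) (hi _), add_mul]
  refine le_trans (le_of_eq ?_) (add_le_add (frobSq_le_integral_quadForm_sq h1)
    (frobSq_le_integral_quadForm_sq h2))
  have e : ∀ i j, ‖((1 / 2 : ℂ) • (N + N.conjTranspose)) i j‖ ^ 2 +
      ‖((Complex.I / 2) • (N.conjTranspose - N)) i j‖ ^ 2 =
      (‖N i j‖ ^ 2 + ‖N j i‖ ^ 2) / 2 := by
    intro i j
    simp only [Matrix.smul_apply, Matrix.add_apply, Matrix.sub_apply, Matrix.conjTranspose_apply,
      ← Complex.normSq_eq_norm_sq, Complex.normSq_apply]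
    simp
    ring
  simp only [frobSq, ← Finset.sum_add_distrib, e]
  simp only [← Finset.sum_div, Finset.sum_add_distrib]
  rw [Finset.sum_comm (f := fun i j => ‖N j i‖ ^ 2)]
  ring

/-- The partial contraction `tr_B (Δ (1 ⊗ Q))`. -/
def contractRight {a b : ℕ} (Δ : Op a b) (Q : Matrix (Fin b) (Fin b) ℂ) :
    Matrix (Fin a) (Fin a) ℂ :=
  fun i i' => ((Matrix.of fun j j' => Δ (i, j) (i', j')) * Q).trace

/-- The partial contraction `tr_A (Δ (P ⊗ 1))`. -/
def contractLeft {a b : ℕ} (Δ : Op a b) (P : Matrix (Fin a) (Fin a) ℂ) :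
    Matrix (Fin b) (Fin b) ℂ :=
  fun j j' => ((Matrix.of fun i i' => Δ (i, j) (i', j')) * P).trace

lemma trace_mul_kronecker_right {a b : ℕ} (Δ : Op a b) (P : Matrix (Fin a) (Fin a) ℂ)
    (Q : Matrix (Fin b) (Fin b) ℂ) :
    (Δ * (P ⊗ₖ Q)).trace = (contractRight Δ Q * P).trace := by
  simp only [Matrix.trace, Matrix.diag, Matrix.mul_apply, Fintype.sum_prod_type,
    Matrix.kroneckerMap_apply, contractRight, Matrix.of_apply, Finset.sum_mul]
  refine Finset.sum_congr rfl fun i _ => ?_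
  rw [Finset.sum_comm]
  refine Finset.sum_congr rfl fun i' _ => Finset.sum_congr rfl fun j _ =>
    Finset.sum_congr rfl fun j' _ => by ring

lemma trace_mul_kronecker_left {a b : ℕ} (Δ : Op a b) (P : Matrix (Fin a) (Fin a) ℂ)
    (Q : Matrix (Fin b) (Fin b) ℂ) :
    (Δ * (P ⊗ₖ Q)).trace = (contractLeft Δ P * Q).trace := by
  simp only [Matrix.trace, Matrix.diag, Matrix.mul_apply, Fintype.sum_prod_type,
    Matrix.kroneckerMap_apply, contractLeft, Matrix.of_apply, Finset.sum_mul]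
  rw [Finset.sum_comm]
  refine Finset.sum_congr rfl fun j _ => ?_
  refine (Finset.sum_congr rfl fun i _ => Finset.sum_comm).trans (Finset.sum_comm.trans ?_)
  refine Finset.sum_congr rfl fun j' _ => Finset.sum_congr rfl fun i _ =>
    Finset.sum_congr rfl fun i' _ => by ring

lemma proj_isHermitian {d : ℕ} (φ : UnitSphere d) : (proj φ).IsHermitian :=
  (Matrix.posSemidef_vecMulVec_self_star _).isHermitian

lemma contractRight_isHermitian {a b : ℕ} {Δ : Op a b} (hΔ : Δ.IsHermitian)
    {Q : Matrix (Fin b) (Fin b) ℂ} (hQ : Q.IsHermitian) : (contractRight Δ Q).IsHermitian := by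
  ext i i'
  simp only [Matrix.conjTranspose_apply, contractRight, Matrix.trace, Matrix.diag,
    Matrix.mul_apply, Matrix.of_apply, star_sum, star_mul']
  rw [Finset.sum_comm]
  refine Finset.sum_congr rfl fun j _ => Finset.sum_congr rfl fun j' _ => ?_
  rw [hΔ.apply, hQ.apply]

lemma contractLeft_isHermitian {a b : ℕ} {Δ : Op a b} (hΔ : Δ.IsHermitian)
    {P : Matrix (Fin a) (Fin a) ℂ} (hP : P.IsHermitian) : (contractLeft Δ P).IsHermitian := by
  ext j j'
  simp only [Matrix.conjTranspose_apply, contractLeft, Matrix.trace, Matrix.diag,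
    Matrix.mul_apply, Matrix.of_apply, star_sum, star_mul']
  rw [Finset.sum_comm]
  refine Finset.sum_congr rfl fun j _ => Finset.sum_congr rfl fun j' _ => ?_
  rw [hΔ.apply, hP.apply]

lemma continuous_proj {d : ℕ} : Continuous (proj : UnitSphere d → Matrix (Fin d) (Fin d) ℂ) := by
  unfold proj
  have h : Continuous fun φ : UnitSphere d => φ.1.ofLp :=
    (PiLp.continuous_ofLp 2 _).comp continuous_subtype_val
  exact h.matrix_vecMulVec h.star

/-- The density of the isotropic law with respect to the product of the uniform measures. -/
def isoDensity {a b : ℕ} (Δ : Op a b) (z : UnitSphere a × UnitSphere b) : ℝ :=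
  (Δ * (((a : ℂ) • proj z.1) ⊗ₖ ((b : ℂ) • proj z.2))).trace.re

lemma isoDensity_eq {a b : ℕ} (Δ : Op a b) (z : UnitSphere a × UnitSphere b) :
    isoDensity Δ z = a * b * (Δ * (proj z.1 ⊗ₖ proj z.2)).trace.re := by
  rw [isoDensity, Matrix.smul_kronecker, Matrix.kronecker_smul, smul_smul, Matrix.mul_smul,
    Matrix.trace_smul, smul_eq_mul, ← Complex.ofReal_natCast, ← Complex.ofReal_natCast,
    ← Complex.ofReal_mul, Complex.re_ofReal_mul]

lemma continuous_isoDensity {a b : ℕ} (Δ : Op a b) : Continuous (isoDensity Δ) := by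
  have h : Continuous fun z : UnitSphere a × UnitSphere b =>
      ((a : ℂ) • proj z.1) ⊗ₖ ((b : ℂ) • proj z.2) := by
    refine continuous_matrix fun i j => ?_
    simp only [Matrix.kroneckerMap_apply]
    exact (((continuous_proj.comp continuous_fst).const_smul (a : ℂ)).matrix_elem _ _).mul
      (((continuous_proj.comp continuous_snd).const_smul (b : ℂ)).matrix_elem _ _)
  exact Complex.continuous_re.comp (continuous_const.matrix_mul h).matrix_trace

/-- The product of the two uniform measures. -/
abbrev uniformProd (a b : ℕ) : Measure (UnitSphere a × UnitSphere b) :=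
  (uniformSphere a).prod (uniformSphere b)

/-- The one-sphere bound is used twice: over `ψ` on each block of `Δ`, then over `φ` on the
contraction with `proj ψ`, which is again Hermitian. -/
lemma frobSq_le_integral_trace_sq {a b : ℕ} [NeZero a] [NeZero b] {Δ : Op a b}
    (hΔ : Δ.IsHermitian) :
    frobSq Δ ≤ (∫ z, (Δ * (proj z.1 ⊗ₖ proj z.2)).trace.re ^ 2 ∂uniformProd a b) *
      (a * (a + 1)) * (b * (b + 1)) := by
  have hcont : Continuous fun z : UnitSphere a × UnitSphere b =>
      (Δ * (proj z.1 ⊗ₖ proj z.2)).trace.re := by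
    have h := (continuous_isoDensity Δ).const_mul ((a : ℝ) * b)⁻¹
    refine h.congr fun z => ?_
    have ha : (a : ℝ) ≠ 0 := NeZero.ne _
    have hb : (b : ℝ) ≠ 0 := NeZero.ne _
    rw [isoDensity_eq]
    field_simp
  have hint : Integrable (fun z : UnitSphere a × UnitSphere b =>
      (Δ * (proj z.1 ⊗ₖ proj z.2)).trace.re ^ 2) (uniformProd a b) :=
    integrable_of_continuous (hcont.pow 2)
  have hentry : ∀ i i', Continuous fun ψ : UnitSphere b => contractRight Δ (proj ψ) i i' :=
    fun i i' => (continuous_const.matrix_mul continuous_proj).matrix_trace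
  have hi : ∀ i i', Integrable (fun ψ : UnitSphere b => ‖contractRight Δ (proj ψ) i i'‖ ^ 2)
      (uniformSphere b) := fun i i' => integrable_of_continuous ((hentry i i').norm.pow 2)
  calc frobSq Δ
      = ∑ i, ∑ i', frobSq (Matrix.of fun j j' => Δ (i, j) (i', j')) := by
        simp only [frobSq, Fintype.sum_prod_type, Matrix.of_apply]
        refine Finset.sum_congr rfl fun i _ => ?_
        rw [Finset.sum_comm]
    _ ≤ ∑ i, ∑ i', (∫ ψ, ‖contractRight Δ (proj ψ) i i'‖ ^ 2 ∂uniformSphere b) *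
          (b * (b + 1)) := by
        refine Finset.sum_le_sum fun i _ => Finset.sum_le_sum fun i' _ => ?_
        refine (frobSq_le_integral_norm_sq _).trans_eq ?_
        simp only [contractRight, proj, trace_mul_vecMulVec]
    _ = (∫ ψ, frobSq (contractRight Δ (proj ψ)) ∂uniformSphere b) * (b * (b + 1)) := by
        simp only [frobSq]
        rw [integral_finsetSum _ fun i _ => integrable_finsetSum _ fun i' _ => hi i i',
          Finset.sum_mul]
        refine Finset.sum_congr rfl fun i _ => ?_
        rw [integral_finsetSum _ fun i' _ => hi i i', Finset.sum_mul]
    _ ≤ (∫ ψ, (∫ φ, (Δ * (proj φ ⊗ₖ proj ψ)).trace.re ^ 2 ∂uniformSphere a) *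
          (a * (a + 1)) ∂uniformSphere b) * (b * (b + 1)) := by
        refine mul_le_mul_of_nonneg_right (integral_mono ?_ ?_ fun ψ => ?_) (by positivity)
        · exact integrable_finsetSum _ fun i _ => integrable_finsetSum _ fun i' _ => hi i i'
        · exact hint.integral_prod_right.mul_const _
        · simp only [trace_mul_kronecker_right, trace_mul_proj]
          exact frobSq_le_integral_quadForm_sq
            (contractRight_isHermitian hΔ (proj_isHermitian ψ))
    _ = _ := by
        rw [integral_mul_const, integral_prod_symm _ hint]

/-- The factors `a(a+1) b(b+1)` of the second moment meet `12a/(a+1) · 12b/(b+1)`, leaving `144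
(ab)²`; the `ab` is absorbed in `isoDensity`, so the constant is dimension-free. -/
theorem frobSq_le_integral_abs_isoDensity {a b : ℕ} [NeZero a] [NeZero b] {Δ : Op a b}
    (hΔ : Δ.IsHermitian) :
    frobSq Δ ≤ 144 * (∫ z, |isoDensity Δ z| ∂uniformProd a b) ^ 2 := by
  have ha : (0 : ℝ) < a := Nat.cast_pos.2 (NeZero.pos a)
  have hb : (0 : ℝ) < b := Nat.cast_pos.2 (NeZero.pos b)
  set F : UnitSphere a × UnitSphere b → ℝ := fun z => (Δ * (proj z.1 ⊗ₖ proj z.2)).trace.re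
    with hF
  have hFc : Continuous F := by
    refine ((continuous_isoDensity Δ).const_mul ((a : ℝ) * b)⁻¹).congr fun z => ?_
    rw [isoDensity_eq]
    field_simp
    rfl
  have h4 := integral_pow_four_prod_le (μ := uniformSphere a) (ν := uniformSphere b) hFc
    (A := 12 * a / (a + 1)) (B := 12 * b / (b + 1)) (by positivity) (by positivity)
    (fun ψ => by
      have := integral_quadForm_pow_four_le
        (contractRight_isHermitian hΔ (proj_isHermitian ψ))
      simp only [hF, trace_mul_kronecker_right, trace_mul_proj]
      rw [div_mul_eq_mul_div, le_div_iff₀ (by positivity)]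
      exact this)
    (fun φ => by
      have := integral_quadForm_pow_four_le
        (contractLeft_isHermitian hΔ (proj_isHermitian φ))
      simp only [hF, trace_mul_kronecker_left, trace_mul_proj]
      rw [div_mul_eq_mul_div, le_div_iff₀ (by positivity)]
      exact this)
  have h2 := integral_sq_le_of_integral_pow_four_le hFc h4
  have h3 := frobSq_le_integral_trace_sq hΔ
  have e : ∫ z, |isoDensity Δ z| ∂uniformProd a b = a * b * ∫ z, |F z| ∂uniformProd a b := by
    rw [← integral_const_mul]
    refine integral_congr_ae (ae_of_all _ fun z => ?_)
    simp only [isoDensity_eq, abs_mul, Nat.abs_cast, hF]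
  rw [e]
  refine h3.trans ((mul_le_mul_of_nonneg_right (mul_le_mul_of_nonneg_right h2
    (by positivity)) (by positivity)).trans_eq ?_)
  field_simp
  ring

open InformationTheory (klFun)

/-! ### Pinsker's inequality for densities -/

/-- The difference of the two sides has derivative `(s - 1)³ / (s² (s + 2)²)`, so its minimum is the
value 0 at `s = 1`. -/
lemma rational_le_log {t : ℝ} (ht : 0 < t) :
    (t - 1) * (5 * t + 1) / (2 * t * (t + 2)) ≤ Real.log t := by
  set ψ : ℝ → ℝ := fun t => Real.log t - (t - 1) * (5 * t + 1) / (2 * t * (t + 2)) with hψ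
  have hd : ∀ s : ℝ, 0 < s → HasDerivAt ψ ((s - 1) ^ 3 / (s ^ 2 * (s + 2) ^ 2)) s := by
    intro s hs
    have h1 : HasDerivAt (fun t : ℝ => (t - 1) * (5 * t + 1)) (1 * (5 * s + 1) + (s - 1) * (5 * 1))
        s := ((hasDerivAt_id s).sub_const 1).mul (((hasDerivAt_id s).const_mul 5).add_const 1)
    have h2 : HasDerivAt (fun t : ℝ => 2 * t * (t + 2)) (2 * 1 * (s + 2) + 2 * s * 1) s :=
      ((hasDerivAt_id s).const_mul 2).mul ((hasDerivAt_id s).add_const 2)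
    have hs0 : 2 * s * (s + 2) ≠ 0 := by positivity
    refine ((Real.hasDerivAt_log hs.ne').sub (h1.div h2 hs0)).congr_deriv ?_
    field_simp
    ring
  have hc : ContinuousOn ψ (Set.Ioi 0) := fun s hs => (hd s hs).continuousAt.continuousWithinAt
  have h1 : ψ 1 = 0 := by simp [hψ]
  suffices 0 ≤ ψ t by simpa [hψ] using this
  rcases le_total 1 t with h | h
  · have hm : MonotoneOn ψ (Set.Ici 1) := by
      refine monotoneOn_of_deriv_nonneg (convex_Ici 1)
        (hc.mono fun s (hs : 1 ≤ s) => lt_of_lt_of_le (one_pos (α := ℝ)) hs) ?_ ?_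
      · rw [interior_Ici]
        exact fun s hs => (hd s (one_pos.trans hs)).differentiableAt.differentiableWithinAt
      · rw [interior_Ici]
        intro s hs
        have hs' : (1 : ℝ) < s := hs
        rw [(hd s (one_pos.trans hs)).deriv]
        have : 0 ≤ s - 1 := by linarith
        positivity
    simpa [h1] using hm Set.self_mem_Ici h h
  · have hm : AntitoneOn ψ (Set.Ioc 0 1) := by
      refine antitoneOn_of_deriv_nonpos (convex_Ioc 0 1) (hc.mono fun s hs => hs.1) ?_ ?_
      · rw [interior_Ioc]
        exact fun s hs => (hd s hs.1).differentiableAt.differentiableWithinAt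
      · rw [interior_Ioc]
        intro s hs
        rw [(hd s hs.1).deriv]
        refine div_nonpos_of_nonpos_of_nonneg ?_ (by have := hs.1; positivity)
        exact Odd.pow_nonpos (by decide) (by linarith [hs.2])
    simpa [h1] using hm ⟨ht, h⟩ ⟨one_pos, le_rfl⟩ h

lemma sub_one_sq_le_klFun {t : ℝ} (ht : 0 ≤ t) :
    (t - 1) ^ 2 ≤ 2 / 3 * (t + 2) * klFun t := by
  rcases ht.eq_or_lt with rfl | ht
  · simp [InformationTheory.klFun_zero]
    norm_num
  · have h := rational_le_log ht
    rw [div_le_iff₀ (by positivity)] at h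
    rw [InformationTheory.klFun_apply]
    nlinarith

/-- The relative entropy density `v · klFun (u / v) = u log (u / v) + v - u`. -/
def klDensity (u v : ℝ) : ℝ := v * klFun (u / v)

lemma klDensity_nonneg {u v : ℝ} (hu : 0 ≤ u) (hv : 0 ≤ v) : 0 ≤ klDensity u v :=
  mul_nonneg hv (InformationTheory.klFun_nonneg (div_nonneg hu hv))

lemma measurable_klDensity {α : Type*} [MeasurableSpace α] {f g : α → ℝ} (hf : Measurable f)
    (hg : Measurable g) : Measurable fun x => klDensity (f x) (g x) :=
  hg.mul (InformationTheory.measurable_klFun.comp (hf.div hg))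

lemma sub_sq_le_klDensity {u v : ℝ} (hu : 0 ≤ u) (hv : 0 ≤ v) (h : v = 0 → u = 0) :
    (u - v) ^ 2 ≤ 2 / 3 * (u + 2 * v) * klDensity u v := by
  rcases hv.eq_or_lt with h0 | hv'
  · simp [← h0, h h0.symm]
  · have := mul_le_mul_of_nonneg_left (sub_one_sq_le_klFun (div_nonneg hu hv)) (sq_nonneg v)
    rw [klDensity]
    calc (u - v) ^ 2 = v ^ 2 * (u / v - 1) ^ 2 := by field_simp
      _ ≤ _ := this
      _ = _ := by field_simp

lemma pinsker {α : Type*} [MeasurableSpace α] {μ : Measure α} {f g : α → ℝ} (hf : Measurable f)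
    (hg : Measurable g) (hf0 : ∀ x, 0 ≤ f x) (hg0 : ∀ x, 0 ≤ g x) (hfg : ∀ x, g x = 0 → f x = 0)
    (hfi : Integrable f μ) (hgi : Integrable g μ) (hf1 : ∫ x, f x ∂μ = 1)
    (hg1 : ∫ x, g x ∂μ = 1) :
    ENNReal.ofReal ((∫ x, |f x - g x| ∂μ) ^ 2 / 2) ≤
      ∫⁻ x, ENNReal.ofReal (klDensity (f x) (g x)) ∂μ := by
  by_cases htop : ∫⁻ x, ENNReal.ofReal (klDensity (f x) (g x)) ∂μ = ⊤
  · simp [htop]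
  have hk0 : ∀ x, 0 ≤ klDensity (f x) (g x) := fun x => klDensity_nonneg (hf0 x) (hg0 x)
  have hki : Integrable (fun x => klDensity (f x) (g x)) μ :=
    (lintegral_ofReal_ne_top_iff_integrable (measurable_klDensity hf hg).aestronglyMeasurable
      (ae_of_all _ hk0)).1 htop
  rw [← ofReal_integral_eq_lintegral_ofReal hki (ae_of_all _ hk0)]
  refine ENNReal.ofReal_le_ofReal ?_
  set D := ∫ x, |f x - g x| ∂μ with hD
  set H := ∫ x, klDensity (f x) (g x) ∂μ with hH
  have hD0 : 0 ≤ D := integral_nonneg fun x => abs_nonneg _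
  have hH0 : 0 ≤ H := integral_nonneg hk0
  rcases hD0.eq_or_lt with h0 | hpos
  · rw [← h0]; simpa using hH0
  -- With `w = f + 2g`, AM–GM gives `|f - g| ≤ √(2wk/3) ≤ D w / 6 + k / D` pointwise. As `∫ w = 3`,
  -- integration gives `D ≤ D/2 + H/D`.
  have key : D ≤ D / 6 * (1 + 2 * 1) + H / D := by
    have hw : Integrable (fun x => D / 6 * (f x + 2 * g x)) μ :=
      (hfi.add (hgi.const_mul 2)).const_mul _
    have e : D / 6 * (1 + 2 * 1) + H / D =
        ∫ x, D / 6 * (f x + 2 * g x) + klDensity (f x) (g x) / D ∂μ := by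
      rw [integral_add hw (hki.div_const _), integral_const_mul, integral_div,
        integral_add hfi (hgi.const_mul 2), integral_const_mul, hf1, hg1]
    rw [e]
    refine integral_mono (hfi.sub hgi).abs (hw.add (hki.div_const _)) fun x => ?_
    simp only
    have h := sub_sq_le_klDensity (hf0 x) (hg0 x) (hfg x)
    set k := klDensity (f x) (g x)
    set w := f x + 2 * g x with hw
    have hw0 : 0 ≤ w := by have := hf0 x; have := hg0 x; positivity
    refine abs_le_of_sq_le_sq (h.trans ?_) (by have := hk0 x; positivity)
    have e : (D / 6 * w + k / D) ^ 2 = 2 / 3 * w * k + (D / 6 * w - k / D) ^ 2 := by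
      field_simp
      ring
    rw [e]
    nlinarith [sq_nonneg (D / 6 * w - k / D)]
  have : D * (H / D) = H := by field_simp
  nlinarith

/-! ### Mutual information in terms of densities -/

lemma klDiv_withDensity {α : Type*} [MeasurableSpace α] {μ : Measure α} {u v : α → ℝ}
    (hu : Measurable u) (hv : Measurable v) (hu0 : ∀ x, 0 ≤ u x) (hv0 : ∀ x, 0 ≤ v x)
    (huv : ∀ᵐ x ∂μ, v x = 0 → u x = 0)
    [IsFiniteMeasure (μ.withDensity fun x => ENNReal.ofReal (u x))]
    [IsFiniteMeasure (μ.withDensity fun x => ENNReal.ofReal (v x))] :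
    InformationTheory.klDiv (μ.withDensity fun x => ENNReal.ofReal (u x))
      (μ.withDensity fun x => ENNReal.ofReal (v x)) =
      ∫⁻ x, ENNReal.ofReal (klDensity (u x) (v x)) ∂μ := by
  set ν := μ.withDensity fun x => ENNReal.ofReal (v x) with hν
  have hm : Measurable fun x => ENNReal.ofReal (u x / v x) := (hu.div hv).ennreal_ofReal
  have hk : Measurable fun x => ENNReal.ofReal (klFun (u x / v x)) :=
    (InformationTheory.measurable_klFun.comp (hu.div hv)).ennreal_ofReal
  have h : (μ.withDensity fun x => ENNReal.ofReal (u x)) =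
      ν.withDensity fun x => ENNReal.ofReal (u x / v x) := by
    rw [hν, ← withDensity_mul _ hv.ennreal_ofReal hm]
    refine withDensity_congr_ae ?_
    filter_upwards [huv] with x hx
    rw [Pi.mul_apply, ← ENNReal.ofReal_mul (hv0 x)]
    rcases eq_or_ne (v x) 0 with h0 | h0
    · simp [h0, hx h0]
    · rw [mul_div_cancel₀ _ h0]
  rw [InformationTheory.klDiv_eq_lintegral_klFun_of_ac
    (h ▸ withDensity_absolutelyContinuous _ _)]
  have hr : (μ.withDensity fun x => ENNReal.ofReal (u x)).rnDeriv ν =ᵐ[ν]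
      fun x => ENNReal.ofReal (u x / v x) := by
    rw [h]
    exact Measure.rnDeriv_withDensity ν hm
  have e : ∫⁻ x, ENNReal.ofReal
      (klFun ((μ.withDensity fun x => ENNReal.ofReal (u x)).rnDeriv ν x).toReal) ∂ν =
      ∫⁻ x, ENNReal.ofReal (klFun (u x / v x)) ∂ν := by
    refine lintegral_congr_ae ?_
    filter_upwards [hr] with x hx
    rw [hx, ENNReal.toReal_ofReal (div_nonneg (hu0 x) (hv0 x))]
  rw [e, hν, lintegral_withDensity_eq_lintegral_mul _ hv.ennreal_ofReal hk]
  refine lintegral_congr fun x => ?_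
  rw [Pi.mul_apply, ← ENNReal.ofReal_mul (hv0 x), klDensity]

section Joint

variable {X Ω : Type*} [MeasurableSpace X] [MeasurableSpace Ω]

lemma lintegral_sum_dirac_prod (p : X → ℝ≥0∞) (P : X → Measure Ω) [∀ x, SFinite (P x)]
    {G : X × Ω → ℝ≥0∞} (hG : Measurable G) :
    ∫⁻ w, G w ∂(Measure.sum fun x => p x • (Measure.dirac x).prod (P x)) =
      ∑' x, p x * ∫⁻ z, G (x, z) ∂P x := by
  rw [lintegral_sum_measure]
  refine tsum_congr fun x => ?_
  rw [lintegral_smul_measure, Measure.dirac_prod, lintegral_map hG measurable_prodMk_left,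
    smul_eq_mul]

lemma sum_dirac_prod_withDensity [Countable X] [DiscreteMeasurableSpace X]
    (p : X → ℝ≥0∞) (μ : Measure Ω) [SFinite μ] (f : X → Ω → ℝ≥0∞)
    (hf : ∀ x, Measurable (f x)) [∀ x, SFinite (μ.withDensity (f x))] :
    (Measure.sum fun x => p x • (Measure.dirac x).prod (μ.withDensity (f x))) =
      (Measure.sum fun x => p x • (Measure.dirac x).prod μ).withDensity fun w => f w.1 w.2 := by
  have hfm : Measurable fun w : X × Ω => f w.1 w.2 := measurable_from_prod_countable_right hf
  ext s hs
  rw [withDensity_apply _ hs, ← lintegral_indicator hs,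
    lintegral_sum_dirac_prod _ _ (hfm.indicator hs), ← lintegral_indicator_one hs,
    lintegral_sum_dirac_prod _ _ (measurable_one.indicator hs)]
  refine tsum_congr fun x => ?_
  have hi : Measurable fun z => s.indicator (1 : X × Ω → ℝ≥0∞) (x, z) :=
    (measurable_one.indicator hs).comp measurable_prodMk_left
  rw [lintegral_withDensity_eq_lintegral_mul _ (hf x) hi]
  congr 1
  refine lintegral_congr fun z => ?_
  by_cases h : (x, z) ∈ s <;> simp [h]

end Joint

/-- Relative to `m = ∑ p_x δ_x ⊗ μ`, the joint law has density `f` and the product of its marginals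
has density `fbar`. The identity holds in `ℝ≥0∞`, with no finiteness of the information assumed. -/
theorem mutualInfo_withDensity {X Ω : Type*} [Countable X] [MeasurableSpace Ω] (p : PMF X)
    (μ : Measure Ω) [IsFiniteMeasure μ] {f : X → Ω → ℝ} {fbar : Ω → ℝ}
    (hf : ∀ x, Measurable (f x)) (hfbar : Measurable fbar) (hf0 : ∀ x z, 0 ≤ f x z)
    (hsum : ∀ z, HasSum (fun x => (p x).toReal * f x z) (fbar z))
    [∀ x, IsProbabilityMeasure (μ.withDensity fun z => ENNReal.ofReal (f x z))] :
    mutualInfo p (fun x => μ.withDensity fun z => ENNReal.ofReal (f x z)) =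
      (∑' x, p x * ∫⁻ z, ENNReal.ofReal (klDensity (f x z) (fbar z)) ∂μ) /
        ENNReal.ofReal (Real.log 2) := by
  let _ : MeasurableSpace X := ⊤
  set P : X → Measure Ω := fun x => μ.withDensity fun z => ENNReal.ofReal (f x z) with hP
  have hfbar0 : ∀ z, 0 ≤ fbar z := fun z =>
    (hsum z).nonneg fun x => mul_nonneg ENNReal.toReal_nonneg (hf0 x z)
  have hfm : Measurable fun w : X × Ω => f w.1 w.2 := measurable_from_prod_countable_right hf
  set m : Measure (X × Ω) := Measure.sum fun x => p x • (Measure.dirac x).prod μ with hm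
  set π : Measure (X × Ω) := Measure.sum fun x => p x • (Measure.dirac x).prod (P x) with hπ
  have hπm : π = m.withDensity fun w => ENNReal.ofReal (f w.1 w.2) :=
    sum_dirac_prod_withDensity p μ _ fun x => (hf x).ennreal_ofReal
  have hπ1 : π Set.univ = 1 := by
    rw [← lintegral_one, hπ, lintegral_sum_dirac_prod _ _ measurable_const]
    simp [p.tsum_coe]
  have hπprob : IsProbabilityMeasure π := ⟨hπ1⟩
  have hfst : π.fst = Measure.sum fun x => p x • Measure.dirac x := by
    ext s hs
    rw [Measure.fst_apply hs, ← lintegral_indicator_one (measurable_fst hs), hπ,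
      lintegral_sum_dirac_prod _ _ (measurable_one.indicator (measurable_fst hs)),
      Measure.sum_apply _ hs]
    refine tsum_congr fun x => ?_
    rw [Measure.smul_apply, Measure.dirac_apply' _ hs, smul_eq_mul]
    by_cases h : x ∈ s <;> simp [h, Set.indicator]
  have hofsum : ∀ z, ENNReal.ofReal (fbar z) = ∑' x, p x * ENNReal.ofReal (f x z) := by
    intro z
    rw [← (hsum z).tsum_eq, ENNReal.ofReal_tsum_of_nonneg
      (fun x => mul_nonneg ENNReal.toReal_nonneg (hf0 x z)) (hsum z).summable]
    refine tsum_congr fun x => ?_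
    rw [ENNReal.ofReal_mul ENNReal.toReal_nonneg, ENNReal.ofReal_toReal (p.apply_ne_top x)]
  have hsnd : π.snd = μ.withDensity fun z => ENNReal.ofReal (fbar z) := by
    ext s hs
    rw [Measure.snd_apply hs, ← lintegral_indicator_one (measurable_snd hs), hπ,
      lintegral_sum_dirac_prod _ _ (measurable_one.indicator (measurable_snd hs)),
      withDensity_apply _ hs]
    simp only [hofsum]
    rw [lintegral_tsum fun x => ((hf x).ennreal_ofReal.const_mul _).aemeasurable]
    refine tsum_congr fun x => ?_
    rw [lintegral_const_mul _ (hf x).ennreal_ofReal, ← withDensity_apply _ hs,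
      ← lintegral_indicator_one hs]
    rfl
  have hprod : π.fst.prod π.snd = m.withDensity fun w => ENNReal.ofReal (fbar w.2) := by
    have : IsFiniteMeasure (μ.withDensity fun z => ENNReal.ofReal (fbar z)) := by
      rw [← hsnd]; infer_instance
    rw [hsnd, prod_withDensity_right hfbar.ennreal_ofReal, hfst, Measure.prod_sum_left]
    simp only [Measure.prod_smul_left, hm]
  have hfin1 : IsFiniteMeasure (m.withDensity fun w => ENNReal.ofReal (f w.1 w.2)) := by
    rw [← hπm]; infer_instance
  have hfin2 : IsFiniteMeasure (m.withDensity fun w => ENNReal.ofReal (fbar w.2)) := by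
    rw [← hprod]; infer_instance
  -- Only almost everywhere: labels of probability zero do not contribute to `fbar`, but they are
  -- `m`-null.
  have hae : ∀ᵐ w ∂m, fbar w.2 = 0 → f w.1 w.2 = 0 := by
    have hpos : ∀ᵐ w ∂m, p w.1 ≠ 0 := by
      have hs : MeasurableSet {w : X × Ω | p w.1 = 0} :=
        measurable_fst (MeasurableSet.of_discrete (s := {x : X | p x = 0}))
      rw [ae_iff]
      simp only [not_not]
      rw [← lintegral_indicator_one hs, hm,
        lintegral_sum_dirac_prod _ _ (measurable_one.indicator hs), ENNReal.tsum_eq_zero]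
      intro x
      by_cases h : p x = 0 <;> simp [h, Set.indicator]
    filter_upwards [hpos] with w hw h0
    have h1 : (p w.1).toReal * f w.1 w.2 ≤ fbar w.2 := le_hasSum (hsum w.2) w.1 fun x _ =>
      mul_nonneg ENNReal.toReal_nonneg (hf0 x w.2)
    have h2 : 0 < (p w.1).toReal := ENNReal.toReal_pos hw (p.apply_ne_top _)
    have h3 := hf0 w.1 w.2
    rw [h0] at h1
    nlinarith
  have hfbarm : Measurable fun w : X × Ω => fbar w.2 := hfbar.comp measurable_snd
  have hkl := klDiv_withDensity (μ := m) hfm hfbarm (fun w => hf0 w.1 w.2)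
    (fun w => hfbar0 w.2) hae
  rw [mutualInfo, mutualInfoOfJoint]
  congr 1
  change InformationTheory.klDiv π (π.fst.prod π.snd) = _
  rw [hprod, hπm, hkl, hm, lintegral_sum_dirac_prod _ _
    (measurable_klDensity hfm hfbarm).ennreal_ofReal]

/-! ### States, ensembles and the isotropic measurement -/

lemma IsState.isHermitian {a b : ℕ} {ρ : Op a b} (h : IsState ρ) : ρ.IsHermitian :=
  h.posSemidef.isHermitian

/-- Nonnegativity of the `2 × 2` principal minor. -/
lemma norm_sq_apply_le_of_posSemidef {n : Type*} [Fintype n] {M : Matrix n n ℂ}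
    (hM : M.PosSemidef) (i j : n) : ‖M i j‖ ^ 2 ≤ (M i i).re * (M j j).re := by
  have h := (hM.submatrix ![i, j]).det_nonneg
  rw [Matrix.det_fin_two] at h
  simp only [Matrix.submatrix_apply, Matrix.cons_val_zero, Matrix.cons_val_one] at h
  have hr : ∀ k, (M k k).im = 0 := fun k => (Complex.nonneg_iff.1 (hM.diag_nonneg (i := k))).2.symm
  have h2 := (Complex.nonneg_iff.1 h).1
  have hji : M j i = star (M i j) := (hM.isHermitian.apply j i).symm
  rw [← Complex.normSq_eq_norm_sq, Complex.normSq_apply]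
  rw [hji] at h2
  simp only [Complex.sub_re, Complex.mul_re, hr, RCLike.star_def, Complex.conj_re,
    Complex.conj_im] at h2 ⊢
  linarith

lemma IsState.frobSq_le_one {a b : ℕ} {ρ : Op a b} (h : IsState ρ) : frobSq ρ ≤ 1 := by
  have htr : ∑ i, (ρ i i).re = 1 := by
    have := congrArg Complex.re h.trace_eq_one
    simpa [Matrix.trace] using this
  calc frobSq ρ ≤ ∑ i, ∑ j, (ρ i i).re * (ρ j j).re :=
        Finset.sum_le_sum fun i _ => Finset.sum_le_sum fun j _ =>
          norm_sq_apply_le_of_posSemidef h.posSemidef i j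
    _ = 1 := by rw [← Finset.sum_mul_sum, htr, one_mul]

lemma IsState.norm_apply_le_one {a b : ℕ} {ρ : Op a b} (h : IsState ρ) (i j : Fin a × Fin b) :
    ‖ρ i j‖ ≤ 1 := by
  refine abs_le_of_sq_le_sq' ?_ zero_le_one |>.2
  rw [one_pow]
  refine le_trans ?_ h.frobSq_le_one
  refine le_trans ?_ (Finset.single_le_sum (f := fun i => ∑ j, ‖ρ i j‖ ^ 2)
    (fun i _ => Finset.sum_nonneg fun j _ => sq_nonneg _) (Finset.mem_univ i))
  exact Finset.single_le_sum (f := fun j => ‖ρ i j‖ ^ 2) (fun j _ => sq_nonneg _)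
    (Finset.mem_univ j)

lemma IsState.neZero {a b : ℕ} {ρ : Op a b} (h : IsState ρ) : NeZero a ∧ NeZero b := by
  have ht := h.trace_eq_one
  refine ⟨⟨?_⟩, ⟨?_⟩⟩
  all_goals
    rintro rfl
    simp [Matrix.trace] at ht

lemma linearEntropy_eq {a b : ℕ} {ρ : Op a b} (h : ρ.IsHermitian) :
    linearEntropy ρ = 1 - frobSq ρ := by
  rw [linearEntropy, trace_mul_self_re h]

/-- The functional `ρ ↦ Re tr (ρ M)`. -/
def reTrace {a b : ℕ} (M : Op a b) : Op a b →ₗ[ℝ] ℝ where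
  toFun ρ := (ρ * M).trace.re
  map_add' ρ σ := by rw [Matrix.add_mul, Matrix.trace_add, Complex.add_re]
  map_smul' r ρ := by
    rw [Matrix.smul_mul, Matrix.trace_smul, Complex.smul_re, RingHom.id_apply]

lemma reTrace_apply {a b : ℕ} (M ρ : Op a b) : reTrace M ρ = (ρ * M).trace.re := rfl

lemma continuous_reTrace {a b : ℕ} (M : Op a b) : Continuous (reTrace M) :=
  Complex.continuous_re.comp (continuous_id.matrix_mul continuous_const).matrix_trace

namespace Ensemble

variable {X : Type*} {a b : ℕ} (E : Ensemble X a b)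

lemma hasSum_prob : HasSum (fun x => (E.p x).toReal) 1 := by
  have h := E.p.tsum_coe
  have h2 := (ENNReal.summable_toReal (f := E.p) (by rw [h]; exact ENNReal.one_ne_top)).hasSum
  rwa [← ENNReal.tsum_toReal_eq fun x => E.p.apply_ne_top x, h, ENNReal.toReal_one] at h2

lemma summable_prob_mul {f : X → ℝ} {C : ℝ} (hf : ∀ x, |f x| ≤ C) :
    Summable fun x => (E.p x).toReal * f x := by
  refine Summable.of_norm_bounded (E.hasSum_prob.summable.mul_right C) fun x => ?_
  rw [norm_mul, Real.norm_of_nonneg ENNReal.toReal_nonneg]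
  exact mul_le_mul_of_nonneg_left (hf x) ENNReal.toReal_nonneg

lemma hasSum_average : HasSum (fun x => (E.p x).toReal • E.ρ x) E.average := by
  refine Summable.hasSum ?_
  refine Pi.summable.2 fun i => Pi.summable.2 fun j => ?_
  refine Summable.of_norm_bounded E.hasSum_prob.summable fun x => ?_
  rw [Matrix.smul_apply, norm_smul, Real.norm_of_nonneg ENNReal.toReal_nonneg]
  exact mul_le_of_le_one_right ENNReal.toReal_nonneg ((E.isState x).norm_apply_le_one i j)

lemma hasSum_reTrace (M : Op a b) :
    HasSum (fun x => (E.p x).toReal * (E.ρ x * M).trace.re) (E.average * M).trace.re := by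
  have h := E.hasSum_average.map (reTrace M) (continuous_reTrace M)
  simpa only [Function.comp_def, map_smul, smul_eq_mul, reTrace_apply] using h

lemma average_isHermitian : E.average.IsHermitian := by
  have h := E.hasSum_average.matrix_conjTranspose
  refine h.unique (E.hasSum_average.congr_fun ?_)
  intro x
  simp [Matrix.conjTranspose_smul, (E.isState x).isHermitian.eq]

lemma trace_average : E.average.trace.re = 1 := by
  have h := E.hasSum_reTrace 1
  simp only [mul_one, (E.isState _).trace_eq_one, Complex.one_re] at h
  exact h.unique E.hasSum_prob

lemma hasSum_frobSq_sub :
    HasSum (fun x => (E.p x).toReal * frobSq (E.ρ x - E.average))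
      (linearEntropy E.average - ∑' x, (E.p x).toReal * linearEntropy (E.ρ x)) := by
  have hσ := E.average_isHermitian
  have hb : ∀ x, |linearEntropy (E.ρ x)| ≤ 1 := fun x => by
    rw [linearEntropy_eq (E.isState x).isHermitian, abs_le]
    have := (E.isState x).frobSq_le_one
    have := frobSq_nonneg (E.ρ x)
    constructor <;> linarith
  have h1 := (E.summable_prob_mul hb).hasSum
  have h2 := E.hasSum_reTrace E.average
  have h3 := ((E.hasSum_prob.mul_right (1 + frobSq E.average)).sub h1).sub (h2.mul_right 2)
  have hv : linearEntropy E.average - ∑' x, (E.p x).toReal * linearEntropy (E.ρ x) =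
      1 * (1 + frobSq E.average) - ∑' x, (E.p x).toReal * linearEntropy (E.ρ x) -
        (E.average * E.average).trace.re * 2 := by
    rw [linearEntropy_eq hσ, trace_mul_self_re hσ]
    ring
  have hf : ∀ x, (E.p x).toReal * frobSq (E.ρ x - E.average) =
      (E.p x).toReal * (1 + frobSq E.average) - (E.p x).toReal * linearEntropy (E.ρ x) -
        (E.p x).toReal * (E.ρ x * E.average).trace.re * 2 := by
    intro x
    have hx := (E.isState x).isHermitian
    have e : frobSq (E.ρ x - E.average) = frobSq (E.ρ x) + frobSq E.average -
        2 * (E.ρ x * E.average).trace.re := by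
      rw [← trace_mul_self_re (hx.sub hσ), ← trace_mul_self_re hx, ← trace_mul_self_re hσ,
        Matrix.sub_mul, Matrix.mul_sub, Matrix.mul_sub, Matrix.trace_sub, Matrix.trace_sub,
        Matrix.trace_sub, Matrix.trace_mul_comm E.average (E.ρ x)]
      simp only [Complex.sub_re]
      ring
    rw [e, linearEntropy_eq hx]
    ring
  rw [hv, funext hf]
  exact h3

end Ensemble

lemma proj_kronecker_proj {a b : ℕ} (φ : UnitSphere a) (ψ : UnitSphere b) :
    proj φ ⊗ₖ proj ψ = Matrix.vecMulVec (fun k : Fin a × Fin b => φ.1 k.1 * ψ.1 k.2)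
      (star fun k : Fin a × Fin b => φ.1 k.1 * ψ.1 k.2) := by
  ext i j
  simp [proj, Matrix.kroneckerMap_apply, Matrix.vecMulVec_apply]
  ring

lemma isoDensity_nonneg {a b : ℕ} {ρ : Op a b} (hρ : ρ.PosSemidef)
    (z : UnitSphere a × UnitSphere b) : 0 ≤ isoDensity ρ z := by
  rw [isoDensity_eq, proj_kronecker_proj, trace_mul_vecMulVec]
  have := hρ.re_dotProduct_nonneg fun k : Fin a × Fin b => z.1.1 k.1 * z.2.1 k.2
  exact mul_nonneg (by positivity) this

lemma integrable_isoDensity {a b : ℕ} [NeZero a] [NeZero b] (Δ : Op a b) :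
    Integrable (isoDensity Δ) (uniformProd a b) :=
  integrable_of_continuous (continuous_isoDensity Δ)

lemma integral_isoDensity {a b : ℕ} [NeZero a] [NeZero b] {Δ : Op a b} (hΔ : Δ.IsHermitian) :
    ∫ z, isoDensity Δ z ∂uniformProd a b = Δ.trace.re := by
  have h1 : ∀ ψ : UnitSphere b, ∫ φ, isoDensity Δ (φ, ψ) ∂uniformSphere a =
      quadForm (contractLeft Δ 1) ψ.1.ofLp * b := by
    intro ψ
    have h := integral_quadForm (contractRight_isHermitian hΔ (proj_isHermitian ψ))
    have e : (contractRight Δ (proj ψ)).trace.re = quadForm (contractLeft Δ 1) ψ.1.ofLp := by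
      rw [← trace_mul_proj, ← trace_mul_kronecker_left, trace_mul_kronecker_right, mul_one]
    simp only [isoDensity_eq, trace_mul_kronecker_right, trace_mul_proj]
    rw [integral_const_mul, ← e, ← h]
    ring
  rw [integral_prod_symm _ (integrable_isoDensity Δ)]
  simp only [h1]
  rw [integral_mul_const, integral_quadForm (contractLeft_isHermitian hΔ Matrix.isHermitian_one),
    ← mul_one (contractLeft Δ 1), ← trace_mul_kronecker_left, Matrix.one_kronecker_one, mul_one]

lemma IsState.isProbabilityMeasure_isotropicLaw {a b : ℕ} {ρ : Op a b} (h : IsState ρ) :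
    IsProbabilityMeasure ((uniformProd a b).withDensity fun z =>
      ENNReal.ofReal (isoDensity ρ z)) := by
  obtain ⟨ha, hb⟩ := h.neZero
  refine ⟨?_⟩
  rw [withDensity_apply _ MeasurableSet.univ, Measure.restrict_univ,
    ← ofReal_integral_eq_lintegral_ofReal (integrable_isoDensity ρ)
      (ae_of_all _ (isoDensity_nonneg h.posSemidef)), integral_isoDensity h.isHermitian,
    h.trace_eq_one, Complex.one_re, ENNReal.ofReal_one]

namespace Ensemble

variable {X : Type*} {a b : ℕ} (E : Ensemble X a b)

lemma neZero (E : Ensemble X a b) : NeZero a ∧ NeZero b := by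
  obtain ⟨x, -⟩ := E.p.support_nonempty
  exact (E.isState x).neZero

lemma hasSum_isoDensity (z : UnitSphere a × UnitSphere b) :
    HasSum (fun x => (E.p x).toReal * isoDensity (E.ρ x) z) (isoDensity E.average z) :=
  E.hasSum_reTrace _

lemma isotropicInfo_eq [Countable X] : isotropicInfo E =
    (∑' x, E.p x * ∫⁻ z, ENNReal.ofReal (klDensity (isoDensity (E.ρ x) z)
      (isoDensity E.average z)) ∂uniformProd a b) / ENNReal.ofReal (Real.log 2) := by
  obtain ⟨ha, hb⟩ := E.neZero
  have := fun x => (E.isState x).isProbabilityMeasure_isotropicLaw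
  exact mutualInfo_withDensity (f := fun x => isoDensity (E.ρ x)) E.p (uniformProd a b)
    (fun x => (continuous_isoDensity (E.ρ x)).measurable)
    (continuous_isoDensity E.average).measurable
    (fun x => isoDensity_nonneg (E.isState x).posSemidef) E.hasSum_isoDensity

lemma isoDensity_average_nonneg (z : UnitSphere a × UnitSphere b) : 0 ≤ isoDensity E.average z :=
  (E.hasSum_isoDensity z).nonneg fun x => mul_nonneg ENNReal.toReal_nonneg
    (isoDensity_nonneg (E.isState x).posSemidef z)

theorem le_isotropicInfo [Countable X] :
    ENNReal.ofReal (1 / (306 * Real.log 2) * (linearEntropy E.average -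
      ∑' x, (E.p x).toReal * linearEntropy (E.ρ x))) ≤ isotropicInfo E := by
  obtain ⟨ha, hb⟩ := E.neZero
  have hlog : 0 < Real.log 2 := Real.log_pos one_lt_two
  have hpos : ∀ x, 0 ≤ (E.p x).toReal * frobSq (E.ρ x - E.average) := fun x =>
    mul_nonneg ENNReal.toReal_nonneg (frobSq_nonneg _)
  have hsum := E.hasSum_frobSq_sub.div_const 306
  rw [E.isotropicInfo_eq, ENNReal.le_div_iff_mul_le
    (Or.inl (by simpa using hlog)) (Or.inl ENNReal.ofReal_ne_top),
    ← ENNReal.ofReal_mul' hlog.le, show ∀ D : ℝ, 1 / (306 * Real.log 2) * D * Real.log 2 = D / 306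
      from fun D => by field_simp, ← hsum.tsum_eq, ENNReal.ofReal_tsum_of_nonneg
      (fun x => div_nonneg (hpos x) (by norm_num)) hsum.summable]
  refine ENNReal.tsum_le_tsum fun x => ?_
  rw [mul_div_assoc, ENNReal.ofReal_mul ENNReal.toReal_nonneg,
    ENNReal.ofReal_toReal (E.p.apply_ne_top x)]
  rcases eq_or_ne (E.p x) 0 with h0 | h0
  · simp [h0]
  have hp : 0 < (E.p x).toReal := ENNReal.toReal_pos h0 (E.p.apply_ne_top x)
  refine mul_le_mul_right (le_trans (ENNReal.ofReal_le_ofReal ?_) (pinsker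
    (continuous_isoDensity (E.ρ x)).measurable (continuous_isoDensity E.average).measurable
    (isoDensity_nonneg (E.isState x).posSemidef) E.isoDensity_average_nonneg ?_
    (integrable_isoDensity _) (integrable_isoDensity _) ?_ ?_)) _
  -- The chain is `‖Δ‖₂² / 306 ≤ ‖Δ‖₂² / 288 ≤ D² / 2`, with `D` the L¹ distance.
  · have h := frobSq_le_integral_abs_isoDensity
      ((E.isState x).isHermitian.sub E.average_isHermitian)
    have e : ∀ z, isoDensity (E.ρ x - E.average) z =
        isoDensity (E.ρ x) z - isoDensity E.average z := fun z =>
      map_sub (reTrace _) (E.ρ x) E.average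
    simp only [e] at h
    have := frobSq_nonneg (E.ρ x - E.average)
    linarith
  · intro z hz
    have h1 := le_hasSum (E.hasSum_isoDensity z) x fun y _ => mul_nonneg ENNReal.toReal_nonneg
      (isoDensity_nonneg (E.isState y).posSemidef z)
    have h2 := isoDensity_nonneg (E.isState x).posSemidef z
    rw [hz] at h1
    nlinarith
  · rw [integral_isoDensity (E.isState x).isHermitian, (E.isState x).trace_eq_one, Complex.one_re]
  · rw [integral_isoDensity E.average_isHermitian, E.trace_average]

end Ensemble

open Filter Topology

/-! ### Product measurements are LOCC -/

lemma exists_conjTranspose_mul_self_of_posSemidef {n : Type*} [Fintype n] [DecidableEq n]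
    {A : Matrix n n ℂ} (hA : A.PosSemidef) : ∃ K : Matrix n n ℂ, K.conjTranspose * K = A := by
  open scoped MatrixOrder in
  obtain ⟨K, hK⟩ := CStarAlgebra.nonneg_iff_eq_star_mul_self.mp hA.nonneg
  exact ⟨K, hK.symm⟩

lemma trace_mul_nonneg_of_posSemidef {n : Type*} [Fintype n] [DecidableEq n] {A B : Matrix n n ℂ}
    (hA : A.PosSemidef) (hB : B.PosSemidef) : 0 ≤ (A * B).trace := by
  obtain ⟨K, rfl⟩ := exists_conjTranspose_mul_self_of_posSemidef hB
  rw [← mul_assoc, Matrix.trace_mul_comm, ← mul_assoc]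
  exact (hA.mul_mul_conjTranspose_same K).trace_nonneg

/-- Alice measures with Kraus operators `K i` satisfying `K i* K i = A i`, Bob likewise for `B`
whatever Alice announced, and the pair of outcomes is the output label. -/
lemma isLOCC_kronecker {a b m n : ℕ} {A : Fin m → Matrix (Fin a) (Fin a) ℂ}
    {B : Fin n → Matrix (Fin b) (Fin b) ℂ} (hA : ∀ i, (A i).PosSemidef)
    (hB : ∀ j, (B j).PosSemidef) (hA1 : ∑ i, A i = 1) (hB1 : ∑ j, B j = 1) :
    IsLOCC fun k : Fin (m * n) =>
      A (finProdFinEquiv.symm k).1 ⊗ₖ B (finProdFinEquiv.symm k).2 := by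
  choose K hK using fun i => exists_conjTranspose_mul_self_of_posSemidef (hA i)
  choose L hL using fun j => exists_conjTranspose_mul_self_of_posSemidef (hB j)
  have h := IsLOCC.alice (b := b) (n := m * n) (fun _ => a) K (by simp only [hK, hA1]) _ fun i =>
    IsLOCC.bob (a := a) (fun _ => b) L (by simp only [hL, hB1]) _ fun j =>
      IsLOCC.done (finProdFinEquiv (i, j))
  convert h using 2 with k
  obtain ⟨⟨i₀, j₀⟩, rfl⟩ := finProdFinEquiv.surjective k
  rw [Equiv.symm_apply_apply, Finset.sum_eq_single i₀, Finset.sum_eq_single j₀]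
  · simp only [if_true, mul_one, Matrix.conjTranspose_kronecker, Matrix.conjTranspose_one,
      ← Matrix.mul_kronecker_mul, one_mul, hK, hL]
  · intro j _ hj
    have : finProdFinEquiv (i₀, j₀) ≠ finProdFinEquiv (i₀, j) := by
      simpa using hj.symm
    rw [if_neg this, mul_zero, zero_mul]
  · simp
  · intro i _ hi
    have : ∀ j, finProdFinEquiv (i₀, j₀) ≠ finProdFinEquiv (i, j) := fun j h =>
      hi (Prod.ext_iff.1 (finProdFinEquiv.injective h)).1.symm
    simp only [if_neg (this _), mul_zero, zero_mul, Finset.sum_const_zero]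
  · simp

/-! ### Finite partitions of compact spaces -/

/-- Each point is sent to the index of a nearest point among finitely many terms of a dense sequence
that form an `ε/2`-net. -/
lemma exists_fin_partition {K : Type*} [PseudoMetricSpace K] [CompactSpace K] [MeasurableSpace K]
    [OpensMeasurableSpace K] [Nonempty K] {ε : ℝ} (hε : 0 < ε) :
    ∃ (n : ℕ) (T : K → Fin n), Measurable T ∧ ∀ x y, T x = T y → dist x y < ε := by
  set e := TopologicalSpace.denseSeq K
  obtain ⟨t, ht⟩ := isCompact_univ.elim_finite_subcover
    (fun k : ℕ => Metric.ball (e k) (ε / 2)) (fun k => Metric.isOpen_ball) fun x _ => by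
      obtain ⟨k, hk⟩ := (TopologicalSpace.denseRange_denseSeq K).exists_dist_lt x (half_pos hε)
      exact Set.mem_iUnion.2 ⟨k, hk⟩
  obtain ⟨N, hN⟩ := t.exists_nat_subset_range
  have hnear : ∀ x, dist (e (SimpleFunc.nearestPtInd e N x)) x < ε / 2 := by
    intro x
    obtain ⟨k, hk, hxk⟩ := Set.mem_iUnion₂.1 (ht (Set.mem_univ x))
    have h := SimpleFunc.edist_nearestPt_le e x (Finset.mem_range.1 (hN hk)).le
    rw [edist_dist, edist_dist, ENNReal.ofReal_le_ofReal_iff dist_nonneg] at h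
    exact h.trans_lt (by rwa [dist_comm])
  refine ⟨N + 1, fun x => ⟨SimpleFunc.nearestPtInd e N x,
    Nat.lt_succ_of_le (SimpleFunc.nearestPtInd_le e N x)⟩, ?_, fun x y hxy => ?_⟩
  · exact measurable_to_countable' fun i => by
      have h := (SimpleFunc.nearestPtInd e N).measurableSet_fiber i
      convert h using 1
      ext x
      simp [Fin.ext_iff]
  · have h := Fin.ext_iff.1 hxy
    simp only at h
    have h1 := hnear x
    have h2 := hnear y
    rw [← h] at h2
    linarith [dist_triangle_left x y (e (SimpleFunc.nearestPtInd e N x))]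

lemma ae_measure_fiber_ne_zero {K : Type*} [MeasurableSpace K] {μ : Measure K} {n : ℕ}
    {T : K → Fin n} :
    ∀ᵐ x ∂μ, μ (T ⁻¹' {T x}) ≠ 0 := by
  rw [ae_iff]
  have : {x | ¬μ (T ⁻¹' {T x}) ≠ 0} = ⋃ i ∈ {i | μ (T ⁻¹' {i}) = 0}, T ⁻¹' {i} := by
    ext x
    simp
  rw [this, measure_biUnion_null_iff (Set.to_countable _)]
  exact fun i hi => hi

lemma tendsto_setAverage_fiber {K : Type*} [PseudoMetricSpace K] [CompactSpace K]
    [MeasurableSpace K] [OpensMeasurableSpace K] {μ : Measure K} [IsFiniteMeasure μ] {N : ℕ → ℕ}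
    {T : ∀ n, K → Fin (N n)} (hT : ∀ n, Measurable (T n))
    (hmesh : ∀ n x y, T n x = T n y → dist x y < 1 / ((n : ℝ) + 1)) {x : K}
    (hx : ∀ n, μ (T n ⁻¹' {T n x}) ≠ 0) {h : K → ℂ} (hh : Continuous h) :
    Tendsto (fun n => ⨍ y in T n ⁻¹' {T n x}, h y ∂μ) atTop (𝓝 (h x)) := by
  rw [Metric.tendsto_atTop]
  intro ε hε
  obtain ⟨δ, hδ, H⟩ := Metric.continuous_iff.1 hh x (ε / 2) (half_pos hε)
  obtain ⟨M, hM⟩ := exists_nat_one_div_lt hδ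
  refine ⟨M, fun n hn => ?_⟩
  have hmem : (⨍ y in T n ⁻¹' {T n x}, h y ∂μ) ∈ Metric.closedBall (h x) (ε / 2) := by
    have hs : MeasurableSet (T n ⁻¹' {T n x}) := hT n (measurableSet_singleton _)
    refine (convex_closedBall _ _).set_average_mem Metric.isClosed_closedBall (hx n)
      (measure_ne_top _ _) ?_ (integrable_of_continuous hh)
    filter_upwards [ae_restrict_mem hs] with y hy
    refine (H y ?_).le
    refine (hmesh n y x hy).trans (lt_of_le_of_lt ?_ hM)
    gcongr
  exact lt_of_le_of_lt hmem (half_lt_self hε)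

/-! ### Quantised uniform POVMs -/

/-- The operator `d ∫ |φ⟩⟨φ| ν(dφ)`. -/
def povmOp {d : ℕ} (ν : Measure (UnitSphere d)) : Matrix (Fin d) (Fin d) ℂ :=
  fun k l => d * ∫ φ, proj φ k l ∂ν

lemma povmOp_isHermitian {d : ℕ} (ν : Measure (UnitSphere d)) : (povmOp ν).IsHermitian := by
  ext k l
  rw [Matrix.conjTranspose_apply, povmOp, povmOp, star_mul', RCLike.star_def, ← integral_conj]
  simp only [map_natCast]
  congr 1
  refine integral_congr_ae (ae_of_all _ fun φ => ?_)
  exact (proj_isHermitian φ).apply k l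

section PovmOp

variable {d : ℕ} (ν : Measure (UnitSphere d)) [IsFiniteMeasure ν]

lemma continuous_proj_apply (k l : Fin d) : Continuous fun φ : UnitSphere d => proj φ k l :=
  continuous_proj.matrix_elem k l

lemma trace_mul_povmOp (M : Matrix (Fin d) (Fin d) ℂ) :
    (M * povmOp ν).trace = d * ∫ φ, (M * proj φ).trace ∂ν := by
  have hi : ∀ k l, Integrable (fun φ : UnitSphere d => M k l * proj φ l k) ν := fun k l =>
    (integrable_of_continuous (continuous_proj_apply l k)).const_mul _
  simp only [Matrix.trace, Matrix.diag, Matrix.mul_apply, povmOp]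
  rw [integral_finsetSum _ fun k _ => integrable_finsetSum _ fun l _ => hi k l, Finset.mul_sum]
  refine Finset.sum_congr rfl fun k _ => ?_
  rw [integral_finsetSum _ fun l _ => hi k l, Finset.mul_sum]
  refine Finset.sum_congr rfl fun l _ => ?_
  rw [integral_const_mul]
  ring

lemma povmOp_posSemidef : (povmOp ν).PosSemidef := by
  refine Matrix.posSemidef_iff_dotProduct_mulVec.2 ⟨povmOp_isHermitian ν, fun v => ?_⟩
  rw [← trace_mul_vecMulVec, Matrix.trace_mul_comm, trace_mul_povmOp]
  refine mul_nonneg (by positivity) (integral_nonneg fun φ => ?_)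
  exact trace_mul_nonneg_of_posSemidef (Matrix.posSemidef_vecMulVec_self_star v)
    (Matrix.posSemidef_vecMulVec_self_star _)

/-- The first-moment formula gives `tr (M · povmOp) = tr M` for Hermitian `M`. Taking `M = D`, the
deviation from the identity itself, yields `tr D² = 0`. -/
lemma povmOp_uniformSphere [NeZero d] : povmOp (uniformSphere d) = 1 := by
  set D := povmOp (uniformSphere d) - 1 with hD
  have hH : D.IsHermitian := (povmOp_isHermitian _).sub Matrix.isHermitian_one
  have h0 : frobSq D = 0 := by
    have hint : Integrable (fun φ : UnitSphere d => (D * proj φ).trace) (uniformSphere d) :=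
      integrable_of_continuous (continuous_const.matrix_mul continuous_proj).matrix_trace
    have h1 : (∫ φ, (D * proj φ).trace ∂uniformSphere d).re =
        ∫ φ, quadForm D φ.1.ofLp ∂uniformSphere d := by
      simp only [← trace_mul_proj]
      exact (integral_re hint).symm
    have h2 : (D * povmOp (uniformSphere d)).trace.re = D.trace.re := by
      rw [trace_mul_povmOp, ← Complex.ofReal_natCast, Complex.re_ofReal_mul, h1,
        ← integral_quadForm hH, mul_comm]
    rw [← trace_mul_self_re hH]
    nth_rewrite 2 [hD]
    rw [Matrix.mul_sub, mul_one, Matrix.trace_sub, Complex.sub_re, h2, sub_self]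
  have h1 : ∀ i j, D i j = 0 := by
    intro i j
    have h2 := (Finset.sum_eq_zero_iff_of_nonneg fun i _ =>
      Finset.sum_nonneg fun j _ => sq_nonneg ‖D i j‖).1 h0 i (Finset.mem_univ i)
    have h3 := (Finset.sum_eq_zero_iff_of_nonneg fun j _ => sq_nonneg ‖D i j‖).1 h2 j
      (Finset.mem_univ j)
    simpa using h3
  exact sub_eq_zero.1 (Matrix.ext h1)

lemma sum_povmOp_restrict {n : ℕ} {T : UnitSphere d → Fin n} (hT : Measurable T) :
    ∑ i, povmOp (ν.restrict (T ⁻¹' {i})) = povmOp ν := by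
  ext k l
  rw [Matrix.sum_apply]
  simp only [povmOp]
  rw [← Finset.mul_sum, ← integral_iUnion_fintype]
  · congr 2
    rw [← Set.preimage_iUnion, Set.iUnion_of_singleton, Set.preimage_univ, Measure.restrict_univ]
  · exact fun i => hT (measurableSet_singleton i)
  · intro i j hij
    exact Disjoint.preimage _ (by simpa using hij)
  · exact fun i => integrable_of_continuous (continuous_proj_apply k l)

end PovmOp

/-- The average of `d |φ⟩⟨φ|` over a cell of the partition defined by `T`. -/
def cellAverage {d n : ℕ} (T : UnitSphere d → Fin n) (i : Fin n) : Matrix (Fin d) (Fin d) ℂ :=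
  ((uniformSphere d).real (T ⁻¹' {i}))⁻¹ • povmOp ((uniformSphere d).restrict (T ⁻¹' {i}))

lemma cellAverage_posSemidef {d n : ℕ} [NeZero d] (T : UnitSphere d → Fin n) (i : Fin n) :
    (cellAverage T i).PosSemidef :=
  (povmOp_posSemidef _).smul (by positivity)

lemma real_smul_cellAverage {d n : ℕ} [NeZero d] (T : UnitSphere d → Fin n) (i : Fin n) :
    (uniformSphere d).real (T ⁻¹' {i}) • cellAverage T i =
      povmOp ((uniformSphere d).restrict (T ⁻¹' {i})) := by
  rw [cellAverage]
  rcases eq_or_ne ((uniformSphere d).real (T ⁻¹' {i})) 0 with h | h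
  -- On a null cell the inverse in `cellAverage` is 0 by convention, and the POVM element vanishes
  -- too.
  · have h0 : (uniformSphere d).restrict (T ⁻¹' {i}) = 0 := by
      rw [Measure.restrict_eq_zero]
      exact (measureReal_eq_zero_iff).1 h
    rw [h, zero_smul, h0]
    ext k l
    simp [povmOp]
  · rw [smul_smul, mul_inv_cancel₀ h, one_smul]

lemma tendsto_cellAverage {d : ℕ} [NeZero d] {N : ℕ → ℕ} {T : ∀ n, UnitSphere d → Fin (N n)}
    (hT : ∀ n, Measurable (T n))
    (hmesh : ∀ n x y, T n x = T n y → dist x y < 1 / ((n : ℝ) + 1)) :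
    ∀ᵐ φ ∂uniformSphere d,
      Tendsto (fun n => cellAverage (T n) (T n φ)) atTop (𝓝 ((d : ℂ) • proj φ)) := by
  filter_upwards [ae_all_iff.2 fun n => ae_measure_fiber_ne_zero (μ := uniformSphere d)
    (T := T n)] with φ hφ
  refine tendsto_pi_nhds.2 fun k => tendsto_pi_nhds.2 fun l => ?_
  have h := (tendsto_setAverage_fiber hT hmesh hφ (continuous_proj_apply k l)).const_mul (d : ℂ)
  refine h.congr fun n => ?_
  rw [setAverage_eq, cellAverage, Matrix.smul_apply, povmOp, mul_smul_comm]

/-! ### The LOCC-accessible information dominates the isotropic information -/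

/-- Lower semicontinuity suffices for Fatou. At `v = 0` continuity may fail, but there `klDensity u
0 = 0`. -/
lemma le_liminf_ofReal_klDensity {u v : ℝ} {U V : ℕ → ℝ} (hU : Tendsto U atTop (𝓝 u))
    (hV : Tendsto V atTop (𝓝 v)) :
    ENNReal.ofReal (klDensity u v) ≤
      liminf (fun n => ENNReal.ofReal (klDensity (U n) (V n))) atTop := by
  rcases eq_or_ne v 0 with rfl | hv
  · simp [klDensity]
  · refine le_of_eq (Tendsto.liminf_eq ?_).symm
    refine ENNReal.tendsto_ofReal (hV.mul ?_)
    exact (InformationTheory.continuous_klFun.tendsto _).comp (hU.div hV hv)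

/-- Fatou for counting measure. -/
lemma tsum_liminf_le {X : Type*} (F : ℕ → X → ℝ≥0∞) :
    ∑' x, liminf (fun n => F n x) atTop ≤ liminf (fun n => ∑' x, F n x) atTop := by
  let _ : MeasurableSpace X := ⊤
  simp only [← lintegral_count]
  exact lintegral_liminf_le fun n => measurable_from_top

lemma mul_lintegral_klDensity_le_liminf {Ω : Type*} [MeasurableSpace Ω] {μ : Measure Ω}
    {c : ℝ≥0∞} (hc : c ≠ ⊤) {f g : Ω → ℝ} {F G : ℕ → Ω → ℝ} (hF : ∀ n, Measurable (F n))
    (hG : ∀ n, Measurable (G n)) (hf : ∀ᵐ z ∂μ, Tendsto (fun n => F n z) atTop (𝓝 (f z)))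
    (hg : ∀ᵐ z ∂μ, Tendsto (fun n => G n z) atTop (𝓝 (g z))) :
    c * ∫⁻ z, ENNReal.ofReal (klDensity (f z) (g z)) ∂μ ≤
      liminf (fun n => c * ∫⁻ z, ENNReal.ofReal (klDensity (F n z) (G n z)) ∂μ) atTop := by
  have h : ∫⁻ z, ENNReal.ofReal (klDensity (f z) (g z)) ∂μ ≤
      liminf (fun n => ∫⁻ z, ENNReal.ofReal (klDensity (F n z) (G n z)) ∂μ) atTop := by
    refine (lintegral_mono_ae ?_).trans (lintegral_liminf_le fun n =>
      (measurable_klDensity (hF n) (hG n)).ennreal_ofReal)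
    filter_upwards [hf, hg] with z h1 h2
    exact le_liminf_ofReal_klDensity h1 h2
  rw [ENNReal.liminf_const_mul_of_ne_top hc]
  exact mul_le_mul_right h c

/-- The density of the quantised isotropic measurement, as a function of the cells. -/
def quantDensity {a b m n : ℕ} (TA : UnitSphere a → Fin m) (TB : UnitSphere b → Fin n)
    (ρ : Op a b) (i : Fin m) (j : Fin n) : ℝ :=
  (ρ * (cellAverage TA i ⊗ₖ cellAverage TB j)).trace.re

lemma quantDensity_nonneg {a b m n : ℕ} [NeZero a] [NeZero b] (TA : UnitSphere a → Fin m)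
    (TB : UnitSphere b → Fin n) {ρ : Op a b} (hρ : ρ.PosSemidef) (i : Fin m) (j : Fin n) :
    0 ≤ quantDensity TA TB ρ i j :=
  (Complex.nonneg_iff.1 (trace_mul_nonneg_of_posSemidef hρ
    ((cellAverage_posSemidef TA i).kronecker (cellAverage_posSemidef TB j)))).1

lemma measurable_quantDensity {a b m n : ℕ} {TA : UnitSphere a → Fin m} {TB : UnitSphere b → Fin n}
    (hA : Measurable TA) (hB : Measurable TB) (ρ : Op a b) :
    Measurable fun z : UnitSphere a × UnitSphere b =>
      quantDensity TA TB ρ (TA z.1) (TB z.2) := by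
  have h : Measurable fun z : UnitSphere a × UnitSphere b => (TA z.1, TB z.2) :=
    (hA.comp measurable_fst).prodMk (hB.comp measurable_snd)
  generalize quantDensity TA TB ρ = q
  have hq : Measurable fun k : Fin m × Fin n => q k.1 k.2 := measurable_of_countable _
  exact hq.comp h

/-- The POVM obtained by quantising the product of the uniform POVMs. -/
def quantPOVM {a b m n : ℕ} (TA : UnitSphere a → Fin m) (TB : UnitSphere b → Fin n)
    (k : Fin (m * n)) : Op a b :=
  povmOp ((uniformSphere a).restrict (TA ⁻¹' {(finProdFinEquiv.symm k).1})) ⊗ₖ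
    povmOp ((uniformSphere b).restrict (TB ⁻¹' {(finProdFinEquiv.symm k).2}))

/-- The cell containing a pair of unit vectors. -/
def quantMap {a b m n : ℕ} (TA : UnitSphere a → Fin m) (TB : UnitSphere b → Fin n)
    (z : UnitSphere a × UnitSphere b) : Fin (m * n) :=
  finProdFinEquiv (TA z.1, TB z.2)

lemma measurable_quantMap {a b m n : ℕ} {TA : UnitSphere a → Fin m} {TB : UnitSphere b → Fin n}
    (hA : Measurable TA) (hB : Measurable TB) : Measurable (quantMap TA TB) :=
  Measurable.of_discrete.comp ((hA.comp measurable_fst).prodMk (hB.comp measurable_snd))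

lemma isProbabilityMeasure_outcomeLaw {a b N : ℕ} {M : Fin N → Op a b} (hM : ∑ k, M k = 1)
    {ρ : Op a b} (hρ : IsState ρ) (hpos : ∀ k, 0 ≤ (ρ * M k).trace.re) :
    IsProbabilityMeasure (outcomeLaw M ρ) := by
  refine ⟨?_⟩
  rw [outcomeLaw, Measure.sum_apply _ MeasurableSet.univ, tsum_fintype]
  simp only [Measure.smul_apply, measure_univ, smul_eq_mul, mul_one]
  rw [← ENNReal.ofReal_sum_of_nonneg fun k _ => hpos k, ← Complex.re_sum, ← Matrix.trace_sum,
    ← Finset.mul_sum, hM, mul_one, hρ.trace_eq_one, Complex.one_re, ENNReal.ofReal_one]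

section Quantised

variable {a b m n : ℕ} [NeZero a] [NeZero b] {TA : UnitSphere a → Fin m}
  {TB : UnitSphere b → Fin n}

lemma isLOCC_quantPOVM (hA : Measurable TA) (hB : Measurable TB) : IsLOCC (quantPOVM TA TB) :=
  isLOCC_kronecker
    (A := fun i => povmOp ((uniformSphere a).restrict (TA ⁻¹' {i})))
    (B := fun j => povmOp ((uniformSphere b).restrict (TB ⁻¹' {j})))
    (fun _ => povmOp_posSemidef _) (fun _ => povmOp_posSemidef _)
    ((sum_povmOp_restrict _ hA).trans povmOp_uniformSphere)
    ((sum_povmOp_restrict _ hB).trans povmOp_uniformSphere)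

lemma sum_quantPOVM (hA : Measurable TA) (hB : Measurable TB) : ∑ k, quantPOVM TA TB k = 1 := by
  rw [← finProdFinEquiv.sum_comp, Fintype.sum_prod_type, ← Matrix.one_kronecker_one,
    ← povmOp_uniformSphere (d := a), ← povmOp_uniformSphere (d := b),
    ← sum_povmOp_restrict _ hA, ← sum_povmOp_restrict _ hB]
  ext k l
  simp only [quantPOVM, Equiv.symm_apply_apply, Matrix.sum_apply, Matrix.kroneckerMap_apply,
    Finset.sum_mul_sum]

lemma map_quantMap_singleton (hA : Measurable TA) (hB : Measurable TB) (k : Fin (m * n)) :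
    (uniformProd a b).map (quantMap TA TB) {k} =
      ENNReal.ofReal ((uniformSphere a).real (TA ⁻¹' {(finProdFinEquiv.symm k).1}) *
        (uniformSphere b).real (TB ⁻¹' {(finProdFinEquiv.symm k).2})) := by
  rw [Measure.map_apply (measurable_quantMap hA hB) (measurableSet_singleton k)]
  have : quantMap TA TB ⁻¹' {k} = (TA ⁻¹' {(finProdFinEquiv.symm k).1}) ×ˢ
      (TB ⁻¹' {(finProdFinEquiv.symm k).2}) := by
    ext z
    simp only [quantMap, Set.mem_preimage, Set.mem_singleton_iff, Set.mem_prod]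
    rw [← Equiv.eq_symm_apply, Prod.ext_iff]
  rw [this, Measure.prod_prod, ENNReal.ofReal_mul measureReal_nonneg, ofReal_measureReal,
    ofReal_measureReal]

/-- Taking the pushed-forward uniform measure as reference lets every quantised information be
pulled back to one fixed space, the product of spheres, where the limit is taken. -/
lemma outcomeLaw_quantPOVM (hA : Measurable TA) (hB : Measurable TB) (ρ : Op a b) :
    outcomeLaw (quantPOVM TA TB) ρ = ((uniformProd a b).map (quantMap TA TB)).withDensity
      fun k => ENNReal.ofReal (quantDensity TA TB ρ (finProdFinEquiv.symm k).1
        (finProdFinEquiv.symm k).2) := by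
  refine Measure.ext_of_singleton fun k => ?_
  rw [withDensity_apply _ (measurableSet_singleton k), lintegral_singleton,
    map_quantMap_singleton hA hB, mul_comm (ENNReal.ofReal _), ← ENNReal.ofReal_mul (by positivity),
    outcomeLaw,
    Measure.sum_apply _ (measurableSet_singleton k), tsum_fintype, Finset.sum_eq_single k]
  · rw [Measure.smul_apply, Measure.dirac_apply_of_mem (Set.mem_singleton k), smul_eq_mul, mul_one,
      quantPOVM, ← real_smul_cellAverage, ← real_smul_cellAverage, Matrix.smul_kronecker,
      Matrix.kronecker_smul, smul_smul, Matrix.mul_smul, Matrix.trace_smul, Complex.smul_re,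
      smul_eq_mul, quantDensity]
  · intro l _ hl
    simp [hl]
  · simp

end Quantised

namespace Ensemble

variable {X : Type*} {a b : ℕ} (E : Ensemble X a b)

lemma tsum_lintegral_quantDensity_le [Countable X] [NeZero a] [NeZero b] {m n : ℕ}
    {TA : UnitSphere a → Fin m} {TB : UnitSphere b → Fin n} (hA : Measurable TA)
    (hB : Measurable TB) :
    (∑' x, E.p x * ∫⁻ z, ENNReal.ofReal (klDensity
      (quantDensity TA TB (E.ρ x) (TA z.1) (TB z.2))
      (quantDensity TA TB E.average (TA z.1) (TB z.2))) ∂uniformProd a b) /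
        ENNReal.ofReal (Real.log 2) ≤ accessibleInfoLOCC E := by
  set g : Op a b → Fin (m * n) → ℝ := fun ρ k =>
    quantDensity TA TB ρ (finProdFinEquiv.symm k).1 (finProdFinEquiv.symm k).2 with hg
  have hprob : ∀ x, IsProbabilityMeasure (((uniformProd a b).map (quantMap TA TB)).withDensity
      fun k => ENNReal.ofReal (g (E.ρ x) k)) := fun x => by
    rw [← outcomeLaw_quantPOVM hA hB]
    exact isProbabilityMeasure_outcomeLaw (sum_quantPOVM hA hB) (E.isState x) fun k =>
      (Complex.nonneg_iff.1 (trace_mul_nonneg_of_posSemidef (E.isState x).posSemidef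
        ((povmOp_posSemidef _).kronecker (povmOp_posSemidef _)))).1
  have h := mutualInfo_withDensity (f := fun x => g (E.ρ x)) (fbar := g E.average) E.p
    ((uniformProd a b).map (quantMap TA TB)) (fun x => Measurable.of_discrete)
    Measurable.of_discrete (fun x k => quantDensity_nonneg TA TB (E.isState x).posSemidef _ _)
    fun k => E.hasSum_reTrace _
  have hle : mutualInfo E.p (fun x => outcomeLaw (quantPOVM TA TB) (E.ρ x)) ≤
      accessibleInfoLOCC E :=
    le_iSup_of_le (m * n) (le_iSup_of_le (quantPOVM TA TB)
      (le_iSup_of_le (isLOCC_quantPOVM hA hB) le_rfl))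
  simp only [outcomeLaw_quantPOVM hA hB] at hle
  refine le_trans (le_of_eq ?_) (h.symm.trans_le hle)
  congr 1
  refine tsum_congr fun x => ?_
  rw [lintegral_map Measurable.of_discrete (measurable_quantMap hA hB)]
  simp only [hg, quantMap, Equiv.symm_apply_apply]

theorem isotropicInfo_le_accessibleInfoLOCC [Countable X] :
    isotropicInfo E ≤ accessibleInfoLOCC E := by
  obtain ⟨ha, hb⟩ := E.neZero
  have hlog : 0 < Real.log 2 := Real.log_pos one_lt_two
  have hne : ∀ d : ℕ, [NeZero d] → Nonempty (UnitSphere d) := fun d _ =>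
    ((NormedSpace.sphere_nonempty (E := EuclideanSpace ℂ (Fin d))).2 zero_le_one).to_subtype
  have := hne a
  have := hne b
  have hε : ∀ n : ℕ, (0 : ℝ) < 1 / ((n : ℝ) + 1) := fun n => by positivity
  choose NA TA hTA hmA using fun n : ℕ => exists_fin_partition (K := UnitSphere a) (hε n)
  choose NB TB hTB hmB using fun n : ℕ => exists_fin_partition (K := UnitSphere b) (hε n)
  -- The null set comes from the cells alone, so a single one serves all `ρ`, including every `ρ_x`
  -- and the average.
  have hconv : ∀ᵐ z ∂uniformProd a b, ∀ ρ : Op a b,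
      Tendsto (fun n => quantDensity (TA n) (TB n) ρ (TA n z.1) (TB n z.2)) atTop
        (𝓝 (isoDensity ρ z)) := by
    filter_upwards [Measure.quasiMeasurePreserving_fst.ae (tendsto_cellAverage hTA hmA),
      Measure.quasiMeasurePreserving_snd.ae (tendsto_cellAverage hTB hmB)] with z h1 h2 ρ
    have hk : Tendsto (fun n => cellAverage (TA n) (TA n z.1) ⊗ₖ cellAverage (TB n) (TB n z.2))
        atTop (𝓝 (((a : ℂ) • proj z.1) ⊗ₖ ((b : ℂ) • proj z.2))) := by
      refine tendsto_pi_nhds.2 fun i => tendsto_pi_nhds.2 fun j => ?_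
      exact ((tendsto_pi_nhds.1 (tendsto_pi_nhds.1 h1 i.1) j.1).mul
        (tendsto_pi_nhds.1 (tendsto_pi_nhds.1 h2 i.2) j.2))
    have hc : Continuous fun M : Op a b => (ρ * M).trace.re :=
      Complex.continuous_re.comp (continuous_const.matrix_mul continuous_id).matrix_trace
    exact (hc.tendsto _).comp hk
  rw [E.isotropicInfo_eq]
  refine ENNReal.div_le_of_le_mul ?_
  have hfatou : ∀ x, E.p x * ∫⁻ z, ENNReal.ofReal (klDensity (isoDensity (E.ρ x) z)
      (isoDensity E.average z)) ∂uniformProd a b ≤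
      liminf (fun n => E.p x * ∫⁻ z, ENNReal.ofReal (klDensity
        (quantDensity (TA n) (TB n) (E.ρ x) (TA n z.1) (TB n z.2))
        (quantDensity (TA n) (TB n) E.average (TA n z.1) (TB n z.2))) ∂uniformProd a b) atTop := by
    intro x
    have hm : ∀ n (ρ : Op a b), Measurable fun z : UnitSphere a × UnitSphere b =>
        quantDensity (TA n) (TB n) ρ (TA n z.1) (TB n z.2) :=
      fun n ρ => measurable_quantDensity (hTA n) (hTB n) ρ
    exact mul_lintegral_klDensity_le_liminf (E.p.apply_ne_top x) (fun n => hm n (E.ρ x))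
      (fun n => hm n E.average) (hconv.mono fun z hz => hz (E.ρ x))
      (hconv.mono fun z hz => hz E.average)
  refine (ENNReal.tsum_le_tsum hfatou).trans ((tsum_liminf_le _).trans ?_)
  refine liminf_le_of_frequently_le' (Frequently.of_forall fun n => ?_)
  have h := E.tsum_lintegral_quantDensity_le (hTA n) (hTB n)
  rwa [ENNReal.div_le_iff (by simpa using hlog) ENNReal.ofReal_ne_top] at h

end Ensemble

lemma linearEntropy_of_isPure {a b : ℕ} {ρ : Op a b} (h : IsPure ρ) : linearEntropy ρ = 0 := by
  obtain ⟨v, hv, rfl⟩ := h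
  rw [linearEntropy, trace_mul_vecMulVec, Matrix.vecMulVec_mulVec, dotProduct_smul, hv]
  simp

end LOCCInfo

end

theorem mainTheorem6 {a b : ℕ} :
    (∀ {X : Type*} [Countable X] (E : LOCCInfo.Ensemble X a b),
      LOCCInfo.isotropicInfo E ≤ LOCCInfo.accessibleInfoLOCC E ∧
      ENNReal.ofReal (1 / (306 * Real.log 2) *
          (LOCCInfo.linearEntropy E.average -
            ∑' x, (E.p x).toReal * LOCCInfo.linearEntropy (E.ρ x))) ≤
        LOCCInfo.isotropicInfo E) ∧
    (∀ ρ : LOCCInfo.Op a b, LOCCInfo.IsState ρ →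
      ENNReal.ofReal (1 / (306 * Real.log 2) * (1 - (ρ * ρ).trace.re)) ≤
        LOCCInfo.subentropyLOCC ρ) := by
  refine ⟨fun E => ⟨E.isotropicInfo_le_accessibleInfoLOCC, E.le_isotropicInfo⟩, fun ρ _ => ?_⟩
  refine le_iInf fun X => le_iInf fun _ => le_iInf fun E => le_iInf fun hE => le_iInf fun hρ => ?_
  subst hρ
  have h := E.le_isotropicInfo.trans E.isotropicInfo_le_accessibleInfoLOCC
  have h0 : ∀ x, LOCCInfo.linearEntropy (E.ρ x) = 0 := fun x =>
    LOCCInfo.linearEntropy_of_isPure (hE x)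
  simp only [h0, mul_zero, tsum_zero, sub_zero] at h
  exact h
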